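/- \textbf{Theorem.} Every finite simple graph $G$ with at most $7$ vertices has an outside-obstacle representation. That is, there exist a topologically open non-self-intersecting polygon $C\subset\mathbb{R}^2$ (the bounded open region enclosed by a simple closed polygonal curve) and a finite set $P\subset\mathbb{R}^2\setminus C$ of points in general position (no three collinear) such that the following two conditions hold. \begin{enumerate} \item $G$ is isomorphic to the visibility graph $G_C(P)$, whose vertex set is $P$ and in which two distinct points $p,q\in P$ are adjacent if and only if $\overline{pq}\cap C=\emptyset$. \item $C$ is an outside obstacle: it is contained in the unbounded component of the complement of the visibility drawing, i.e.\ of the union of $P$ and all segments $\overline{pq}$ for which $pq$ is an edge of $G_C(P)$. \end{enumerate} -/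

import Mathlib

/-- The Euclidean plane. -/
abbrev Plane : Type := EuclideanSpace ℝ (Fin 2)

/-- A polygon is simple (non-self-intersecting) if it has at least three vertices, these are
pairwise distinct, and two different edges meet at most in a common endpoint. -/
structure Polygon.IsSimple {n : ℕ} (w : Polygon Plane n) : Prop where
  three_le : 3 ≤ n
  injective : Function.Injective w.vertices
  inter_subset : ∀ i j : Fin n, i ≠ j →
    w.edgeSet ℝ i ∩ w.edgeSet ℝ j ⊆
      {w i, w (finRotate n i)} ∩ {w j, w (finRotate n j)}

/-- A topologically open non-self-intersecting polygon, that is, the region enclosed by a simple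
closed polygonal curve: the bounded nonempty connected open set whose boundary is that curve. -/
structure IsOpenPolygon (C : Set Plane) : Prop where
  isOpen : IsOpen C
  isConnected : IsConnected C
  isBounded : Bornology.IsBounded C
  exists_frontier_eq : ∃ (n : ℕ) (w : Polygon Plane n), w.IsSimple ∧ frontier C = w.boundary ℝ

/-- A set of points in the plane is in general position if no three of its points are collinear. -/
def InGeneralPosition (P : Set Plane) : Prop :=
  ∀ p ∈ P, ∀ q ∈ P, ∀ r ∈ P, p ≠ q → p ≠ r → q ≠ r → ¬ Collinear ℝ {p, q, r}

/-- The visibility graph of the points `P` with respect to the obstacle `C`: two distinct points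
are adjacent if and only if the closed segment between them does not meet `C`. -/
def visibilityGraph (C P : Set Plane) : SimpleGraph P where
  Adj p q := p ≠ q ∧ Disjoint (segment ℝ (p : Plane) (q : Plane)) C
  symm := ⟨fun p q h => ⟨h.1.symm, by rw [segment_symm]; exact h.2⟩⟩
  loopless := ⟨fun _ h => h.1 rfl⟩

/-- The point set of the visibility drawing: the points of `P` together with the straight-line
segments that represent the edges of the visibility graph. -/
def visibilityDrawing (C P : Set Plane) : Set Plane :=
  P ∪ ⋃ (p : P) (q : P) (_ : (visibilityGraph C P).Adj p q), segment ℝ (p : Plane) (q : Plane)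

/-- The unbounded component of the complement of a bounded set `D` in the plane. -/
def unboundedComponent (D : Set Plane) : Set Plane :=
  {x | x ∈ Dᶜ ∧ ¬ Bornology.IsBounded (connectedComponentIn Dᶜ x)}

/-- `C` and `P` form an outside-obstacle representation of `G`: `C` is an open simple polygon, `P`
is a finite set of points in general position in the complement of `C` whose visibility graph with
respect to `C` is (isomorphic to) `G`, and `C` lies in the unbounded component of the complement
of the visibility drawing. -/
structure IsOutsideObstacleRepresentation {V : Type*} (G : SimpleGraph V) (C P : Set Plane) :
    Prop where
  isOpenPolygon : IsOpenPolygon C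
  finite : P.Finite
  inGeneralPosition : InGeneralPosition P
  subset_compl : P ⊆ Cᶜ
  nonempty_iso : Nonempty (G ≃g visibilityGraph C P)
  outside : C ⊆ unboundedComponent (visibilityDrawing C P)

/-- The graph `G` can be represented by a single outside obstacle. -/
def HasOutsideObstacleRepresentation {V : Type*} (G : SimpleGraph V) : Prop :=
  ∃ C P : Set Plane, IsOutsideObstacleRepresentation G C P

/-- A closed polygonal chain `v 0, …, v n = v 0` that does not intersect itself. -/
structure IsSimpleChain {E : Type*} [AddCommGroup E] [Module ℝ E] (n : ℕ) (v : ℕ → E) : Prop where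
  three_le : 3 ≤ n
  closed : v n = v 0
  inj : ∀ a < n, ∀ b < n, v a = v b → a = b
  inter : ∀ a b, a < b → b < n → segment ℝ (v a) (v (a + 1)) ∩ segment ℝ (v b) (v (b + 1)) ⊆
    {v a, v (a + 1)} ∩ {v b, v (b + 1)}

/-- The union of the edges of a polygonal chain. -/
def chainSet {E : Type*} [AddCommGroup E] [Module ℝ E] (n : ℕ) (v : ℕ → E) : Set E :=
  ⋃ j < n, segment ℝ (v j) (v (j + 1))

/-- A bounded connected open set whose frontier is the simple closed chain `v`. -/
structure IsChainRegion {E : Type*} [NormedAddCommGroup E] [NormedSpace ℝ E]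
    (n : ℕ) (v : ℕ → E) (C : Set E) : Prop where
  isOpen : IsOpen C
  isConnected : IsConnected C
  isBounded : Bornology.IsBounded C
  chain : IsSimpleChain n v
  frontier_eq : frontier C = chainSet n v

section Chain

variable {E F : Type*} [NormedAddCommGroup E] [NormedSpace ℝ E]
  [NormedAddCommGroup F] [NormedSpace ℝ F]

theorem mem_chainSet {n : ℕ} {v : ℕ → E} {x : E} :
    x ∈ chainSet n v ↔ ∃ j < n, x ∈ segment ℝ (v j) (v (j + 1)) := by
  simp [chainSet]

theorem ContinuousAffineEquiv.image_segment_eq (e : E ≃ᴬ[ℝ] F) (x y : E) :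
    e '' segment ℝ x y = segment ℝ (e x) (e y) :=
  image_segment ℝ (e.toAffineEquiv : E →ᵃ[ℝ] F) x y

theorem IsSimpleChain.map {n : ℕ} {v : ℕ → E} (h : IsSimpleChain n v) (e : E ≃ᴬ[ℝ] F) :
    IsSimpleChain n (e ∘ v) where
  three_le := h.three_le
  closed := congrArg e h.closed
  inj a ha b hb hab := h.inj a ha b hb (e.injective hab)
  inter a b hab hb := by
    simp only [Function.comp_apply]
    rw [← e.image_segment_eq, ← e.image_segment_eq, ← Set.image_inter e.injective]
    rintro _ ⟨x, hx, rfl⟩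
    have := h.inter a b hab hb hx
    simpa [e.injective.eq_iff] using this

theorem chainSet_map (n : ℕ) (v : ℕ → E) (e : E ≃ᴬ[ℝ] F) :
    chainSet n (e ∘ v) = e '' chainSet n v := by
  simp [chainSet, Set.image_iUnion, e.image_segment_eq]

theorem IsChainRegion.map [FiniteDimensional ℝ E] {n : ℕ} {v : ℕ → E}
    {C : Set E} (h : IsChainRegion n v C) (e : E ≃ᴬ[ℝ] F) :
    IsChainRegion n (e ∘ v) (e '' C) where
  isOpen := e.toHomeomorph.isOpenMap _ h.isOpen
  isConnected := h.isConnected.image _ e.toHomeomorph.continuous.continuousOn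
  isBounded := by
    have := FiniteDimensional.proper_real E
    have hc : IsCompact (closure C) := h.isBounded.isCompact_closure
    exact (hc.image e.toHomeomorph.continuous).isBounded.subset
      (Set.image_mono subset_closure)
  chain := h.chain.map e
  frontier_eq := by
    rw [chainSet_map, ← h.frontier_eq]
    exact (e.toHomeomorph.image_frontier C).symm

theorem IsSimpleChain.exists_rotate {n : ℕ} {v : ℕ → E} (h : IsSimpleChain n v) {i : ℕ}
    (hi : i < n) : ∃ v' : ℕ → E, IsSimpleChain n v' ∧ chainSet n v' = chainSet n v ∧
      v' (n - 1) = v i ∧ v' n = v (i + 1) := by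
  have hn : 0 < n := by omega
  have hv : ∀ j, v ((j + 1) % n) = v (j % n + 1) := by
    intro j
    have hj := Nat.mod_lt j hn
    rw [Nat.add_mod, Nat.mod_eq_of_lt (by have := h.three_le; omega : 1 < n)]
    rcases eq_or_ne (j % n + 1) n with h1 | h1
    · rw [h1, Nat.mod_self, h.closed]
    · rw [Nat.mod_eq_of_lt (by omega)]
  have hv' : ∀ j, v ((j + 1 + i + 1) % n) = v ((j + i + 1) % n + 1) := fun j => by
    rw [← hv, show j + 1 + i + 1 = j + i + 1 + 1 by ring]
  have hinj : ∀ a < n, ∀ b < n, (a + i + 1) % n = (b + i + 1) % n → a = b := by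
    intro a ha b hb hab
    have h1 : a + (i + 1) ≡ b + (i + 1) [MOD n] := by simpa [Nat.ModEq, add_assoc] using hab
    have h2 := Nat.ModEq.add_right_cancel' _ h1
    rwa [Nat.ModEq, Nat.mod_eq_of_lt ha, Nat.mod_eq_of_lt hb] at h2
  refine ⟨fun j => v ((j + i + 1) % n), ⟨h.three_le, ?_, ?_, ?_⟩, ?_, ?_, ?_⟩
  · rw [show n + i + 1 = (0 + i + 1) + n by ring, Nat.add_mod_right]
  · intro a ha b hb hab
    exact hinj a ha b hb (h.inj _ (Nat.mod_lt _ hn) _ (Nat.mod_lt _ hn) hab)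
  · intro a b hab hb
    simp only [hv']
    rcases lt_trichotomy ((a + i + 1) % n) ((b + i + 1) % n) with h1 | h1 | h1
    · exact h.inter _ _ h1 (Nat.mod_lt _ hn)
    · exact absurd (hinj a (hab.trans hb) b hb h1) hab.ne
    · rw [Set.inter_comm, Set.inter_comm {_, _}]
      exact h.inter _ _ h1 (Nat.mod_lt _ hn)
  · ext x
    simp only [mem_chainSet, hv']
    constructor
    · rintro ⟨j, -, hx⟩
      exact ⟨_, Nat.mod_lt _ hn, hx⟩
    · rintro ⟨j, hj, hx⟩
      refine ⟨(j + (n - (i + 1))) % n, Nat.mod_lt _ hn, ?_⟩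
      have : ((j + (n - (i + 1))) % n + i + 1) % n = j := by
        rw [add_assoc, Nat.mod_add_mod, show j + (n - (i + 1)) + (i + 1) = j + n by omega,
          Nat.add_mod_right, Nat.mod_eq_of_lt hj]
      rwa [this]
  · dsimp only
    rw [show n - 1 + i + 1 = i + n by omega, Nat.add_mod_right, Nat.mod_eq_of_lt hi]
  · dsimp only
    rw [show n + i + 1 = (i + 1) + n by omega, Nat.add_mod_right, hv, Nat.mod_eq_of_lt hi]

theorem IsChainRegion.isOpenPolygon {n : ℕ} {v : ℕ → Plane} {C : Set Plane}
    (h : IsChainRegion n v C) : IsOpenPolygon C := by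
  refine ⟨h.isOpen, h.isConnected, h.isBounded, n, ⟨fun i => v i⟩, ?_, ?_⟩
  all_goals
    have h3 := h.chain.three_le
    obtain ⟨m, rfl⟩ : ∃ m, n = m + 1 := ⟨n - 1, by omega⟩
    have hrot : ∀ i : Fin (m + 1), v (finRotate (m + 1) i : Fin (m + 1)) = v (i + 1) := by
      intro i
      rw [finRotate_apply]
      rcases eq_or_ne i (Fin.last m) with rfl | hi
      · simp [h.chain.closed]
      · rw [Fin.val_add_one_of_lt (Fin.lt_last_iff_ne_last.2 hi)]
  · refine ⟨h3, fun i j hij => Fin.ext (h.chain.inj _ i.2 _ j.2 hij), fun i j hij => ?_⟩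
    simp only [Polygon.edgeSet, affineSegment_eq_segment, hrot]
    rcases lt_or_gt_of_ne hij with h1 | h1
    · exact h.chain.inter _ _ h1 j.2
    · rw [Set.inter_comm, Set.inter_comm {_, _}]
      exact h.chain.inter _ _ h1 i.2
  · rw [h.frontier_eq]
    ext x
    simp only [mem_chainSet, Polygon.boundary, Polygon.edgeSet, affineSegment_eq_segment, hrot,
      Set.mem_iUnion]
    exact ⟨fun ⟨j, hj, hx⟩ => ⟨⟨j, hj⟩, hx⟩, fun ⟨j, hx⟩ => ⟨j, j.2, hx⟩⟩

end Chain

section Spike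

theorem mem_segment_prod_iff {p q x : ℝ × ℝ} : x ∈ segment ℝ p q ↔
    ∃ t : ℝ, 0 ≤ t ∧ t ≤ 1 ∧ x.1 = p.1 + t * (q.1 - p.1) ∧ x.2 = p.2 + t * (q.2 - p.2) := by
  rw [segment_eq_image']
  constructor
  · rintro ⟨t, ht, rfl⟩
    exact ⟨t, ht.1, ht.2, by simp, by simp⟩
  · rintro ⟨t, h0, h1, h2, h3⟩
    exact ⟨t, ⟨h0, h1⟩, Prod.ext (by simp [h2]) (by simp [h3])⟩

theorem mem_segment_of_slope {a b c d m : ℝ} (hab : a < b) (hm : d = c + m * (b - a))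
    {x : ℝ × ℝ} : x ∈ segment ℝ (a, c) (b, d) ↔ a ≤ x.1 ∧ x.1 ≤ b ∧ x.2 = c + m * (x.1 - a) := by
  rw [mem_segment_prod_iff]
  have hba : 0 < b - a := by linarith
  constructor
  · rintro ⟨t, h0, h1, h2, h3⟩
    dsimp only at h2 h3
    refine ⟨by rw [h2]; nlinarith, by rw [h2]; nlinarith, ?_⟩
    rw [h3, h2, hm]
    ring
  · rintro ⟨h0, h1, h2⟩
    refine ⟨(x.1 - a) / (b - a), div_nonneg (by linarith) hba.le, ?_, ?_, ?_⟩
    · rw [div_le_one hba]; linarith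
    · field_simp; ring
    · rw [h2, hm]; field_simp; ring

theorem mem_segment_vertical {a c d : ℝ} (hcd : c ≤ d) {x : ℝ × ℝ} :
    x ∈ segment ℝ (a, c) (a, d) ↔ x.1 = a ∧ c ≤ x.2 ∧ x.2 ≤ d := by
  rw [← Prod.image_mk_segment_right, segment_eq_Icc hcd]
  constructor
  · rintro ⟨y, hy, rfl⟩
    exact ⟨rfl, hy.1, hy.2⟩
  · rintro ⟨rfl, h⟩
    exact ⟨x.2, h, rfl⟩

/-- The open isosceles triangle with apex `(-h, 0)` and base on the line `x = η`. -/
def spike (h η k : ℝ) : Set (ℝ × ℝ) := {x | x.1 < η ∧ |x.2| < k * (x.1 + h)}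

variable {h η k : ℝ}

theorem isOpen_spike : IsOpen (spike h η k) :=
  have h1 : IsOpen {x : ℝ × ℝ | x.1 < η} := isOpen_lt (by fun_prop) (by fun_prop)
  have h2 : IsOpen {x : ℝ × ℝ | |x.2| < k * (x.1 + h)} := isOpen_lt (by fun_prop) (by fun_prop)
  h1.inter h2

theorem openSegment_subset_spike {x y : ℝ × ℝ} (hx : x.1 ≤ η ∧ |x.2| ≤ k * (x.1 + h))
    (hy : y ∈ spike h η k) : openSegment ℝ x y ⊆ spike h η k := by
  rintro _ ⟨a, b, ha, hb, hab, rfl⟩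
  obtain ⟨hx1, hx2⟩ := hx
  obtain ⟨hy1, hy2⟩ := hy
  rw [abs_le] at hx2
  rw [abs_lt] at hy2
  obtain rfl : a = 1 - b := by linarith
  refine ⟨?_, abs_lt.2 ⟨?_, ?_⟩⟩ <;> simp only [Prod.fst_add, Prod.snd_add, Prod.smul_fst,
    Prod.smul_snd, smul_eq_mul] <;> nlinarith

theorem convex_spike : Convex ℝ (spike h η k) :=
  convex_iff_openSegment_subset.2 fun _ hx _ hy =>
    openSegment_subset_spike ⟨hx.1.le, hx.2.le⟩ hy

theorem spike_nonempty (hh : 0 < h) (hη : 0 < η) (hk : 0 < k) : (spike h η k).Nonempty :=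
  ⟨(0, 0), hη, by simpa using mul_pos hk hh⟩

theorem closure_spike (hh : 0 < h) (hη : 0 < η) (hk : 0 < k) :
    closure (spike h η k) = {x | x.1 ≤ η ∧ |x.2| ≤ k * (x.1 + h)} := by
  apply subset_antisymm
  · refine closure_minimal (fun x hx => ⟨hx.1.le, hx.2.le⟩) ?_
    have h1 : IsClosed {x : ℝ × ℝ | x.1 ≤ η} := isClosed_le (by fun_prop) (by fun_prop)
    have h2 : IsClosed {x : ℝ × ℝ | |x.2| ≤ k * (x.1 + h)} :=
      isClosed_le (by fun_prop) (by fun_prop)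
    exact h1.inter h2
  · intro x hx
    obtain ⟨y, hy⟩ := spike_nonempty hh hη hk
    have := closure_mono (openSegment_subset_spike hx hy)
    rw [closure_openSegment] at this
    exact this (left_mem_segment ℝ x y)

theorem isBounded_spike (hk : 0 < k) : Bornology.IsBounded (spike h η k) := by
  refine (Metric.isBounded_Icc ((-h, -(k * (η + h))) : ℝ × ℝ) (η, k * (η + h))).subset ?_
  rintro x ⟨h1, h2⟩
  have h3 := (abs_nonneg _).trans_lt h2
  have h4 : 0 < x.1 + h := (mul_pos_iff_of_pos_left hk).1 h3
  rw [abs_lt] at h2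
  refine ⟨⟨?_, ?_⟩, ⟨?_, ?_⟩⟩ <;> dsimp only <;> nlinarith

theorem isChainRegion_spike (hh : 0 < h) (hη : 0 < η) (hk : 0 < k) :
    ∃ n v, IsChainRegion n v (spike h η k) := by
  have hl : 0 < η + h := by linarith
  have hkl : 0 < k * (η + h) := mul_pos hk hl
  set v : ℕ → ℝ × ℝ := fun j => if j = 1 then (η, k * (η + h)) else
    if j = 2 then (η, -(k * (η + h))) else (-h, 0) with hv
  have v0 : v 0 = (-h, 0) := rfl
  have v1 : v 1 = (η, k * (η + h)) := rfl
  have v2 : v 2 = (η, -(k * (η + h))) := rfl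
  have v3 : v 3 = (-h, 0) := rfl
  have e0 : ∀ x, x ∈ segment ℝ (v 0) (v 1) ↔ -h ≤ x.1 ∧ x.1 ≤ η ∧ x.2 = 0 + k * (x.1 - -h) :=
    fun x => mem_segment_of_slope (by linarith) (by ring)
  have e1 : ∀ x, x ∈ segment ℝ (v 1) (v 2) ↔ x.1 = η ∧ -(k * (η + h)) ≤ x.2 ∧ x.2 ≤ k * (η + h) :=
    fun x => by rw [segment_symm, v1, v2]; exact mem_segment_vertical (by linarith)
  have e2 : ∀ x, x ∈ segment ℝ (v 2) (v 3) ↔ -h ≤ x.1 ∧ x.1 ≤ η ∧ x.2 = 0 + (-k) * (x.1 - -h) :=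
    fun x => by
      rw [segment_symm, v2, v3]
      exact mem_segment_of_slope (by linarith) (by ring)
  refine ⟨3, v, isOpen_spike, ⟨spike_nonempty hh hη hk, convex_spike.isPreconnected⟩,
    isBounded_spike hk, ⟨le_rfl, rfl, ?_, ?_⟩, ?_⟩
  · intro a ha b hb hab
    interval_cases a <;> interval_cases b <;> simp [v0, v1, v2] at hab ⊢ <;> linarith
  · intro a b hab hb x hx
    have : (a = 0 ∧ b = 1) ∨ (a = 0 ∧ b = 2) ∨ (a = 1 ∧ b = 2) := by omega
    rcases this with ⟨rfl, rfl⟩ | ⟨rfl, rfl⟩ | ⟨rfl, rfl⟩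
    · have h1 := (e0 x).1 hx.1
      have h2 := (e1 x).1 hx.2
      have : x = v 1 := Prod.ext h2.1 (by rw [h1.2.2, h2.1, v1]; ring)
      simp [this]
    · have h1 := (e0 x).1 hx.1
      have h2 := (e2 x).1 hx.2
      have h3 : k * (x.1 + h) = 0 := by linarith
      have h4 : x.1 + h = 0 := (mul_eq_zero.1 h3).resolve_left hk.ne'
      have : x = v 0 := Prod.ext (by rw [v0]; dsimp only; linarith)
        (by rw [h1.2.2, v0]; dsimp only; linarith)
      simp [this, v0, v3]
    · have h1 := (e1 x).1 hx.1
      have h2 := (e2 x).1 hx.2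
      have : x = v 2 := Prod.ext h1.1 (by rw [h2.2.2, h1.1, v2]; ring)
      simp [this]
  · rw [isOpen_spike.frontier_eq, closure_spike hh hη hk]
    ext x
    rw [mem_chainSet]
    constructor
    · rintro ⟨⟨h1, h2⟩, h3⟩
      have h0 : 0 ≤ x.1 + h := (mul_nonneg_iff_of_pos_left hk).1 ((abs_nonneg _).trans h2)
      rcases h1.lt_or_eq with h4 | h4
      · have h5 : |x.2| = k * (x.1 + h) := le_antisymm h2 (not_lt.1 fun h5 => h3 ⟨h4, h5⟩)
        rcases abs_choice x.2 with h6 | h6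
        · exact ⟨0, by norm_num, (e0 x).2 ⟨by linarith, h1, by linarith⟩⟩
        · exact ⟨2, by norm_num, (e2 x).2 ⟨by linarith, h1, by linarith⟩⟩
      · rw [h4, abs_le] at h2
        exact ⟨1, by norm_num, (e1 x).2 ⟨h4, h2⟩⟩
    · rintro ⟨j, hj, hx⟩
      interval_cases j
      · obtain ⟨h1, h2, h3⟩ := (e0 x).1 hx
        have h4 : |x.2| = k * (x.1 + h) := by
          rw [h3, abs_of_nonneg] <;> nlinarith
        exact ⟨⟨h2, h4.le⟩, fun h5 => h5.2.ne h4⟩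
      · obtain ⟨h1, h2⟩ := (e1 x).1 hx
        exact ⟨⟨h1.le, by rwa [h1, abs_le]⟩, fun h5 => h5.1.ne h1⟩
      · obtain ⟨h1, h2, h3⟩ := (e2 x).1 hx
        have h4 : |x.2| = k * (x.1 + h) := by
          rw [h3, abs_of_nonpos] <;> nlinarith
        exact ⟨⟨h2, h4.le⟩, fun h5 => h5.2.ne h4⟩

end Spike

section AddSpike

theorem IsChainRegion.union_spike {n : ℕ} {v : ℕ → ℝ × ℝ} {C : Set (ℝ × ℝ)}
    (hC : IsChainRegion n v C) {h η k lo hi : ℝ} (hh : 0 < h) (hη : 0 < η) (hk : 0 < k)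
    (hlo : k * h < lo) (hhi : k * h < hi) (hv1 : v (n - 1) = (0, -lo)) (hv0 : v n = (0, hi))
    (hin : ∀ x : ℝ × ℝ, 0 < x.1 → x.1 ≤ η → |x.2| ≤ k * (x.1 + h) → x ∈ C)
    (hout : ∀ x : ℝ × ℝ, x.1 < 0 → |x.2| ≤ k * (x.1 + h) → x ∉ closure C) :
    ∃ v', IsChainRegion (n + 3) v' (C ∪ spike h η k) := by
  have hn := hC.chain.three_le
  have hkh : 0 < k * h := mul_pos hk hh
  have hfr : frontier C = closure C \ C := hC.isOpen.frontier_eq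
  set v' : ℕ → ℝ × ℝ := fun j => if j < n then v j else if j = n then (0, -(k * h)) else
    if j = n + 1 then (-h, 0) else if j = n + 2 then (0, k * h) else v n with hv'
  have vlt : ∀ j < n, v' j = v j := fun j hj => if_pos hj
  have vn : v' n = (0, -(k * h)) := by simp [hv']
  have vn1 : v' (n + 1) = (-h, 0) := by simp [hv']
  have vn2 : v' (n + 2) = (0, k * h) := by simp [hv']
  have vn3 : v' (n + 3) = (0, hi) := by simp [hv', hv0]
  have hnn : n - 1 + 1 = n := by omega
  have vpred : v' (n - 1) = (0, -lo) := by rw [vlt _ (by omega), hv1]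
  -- the edges of the old and of the new chain
  have eold : ∀ x, x ∈ segment ℝ (v (n - 1)) (v (n - 1 + 1)) ↔
      x.1 = 0 ∧ -lo ≤ x.2 ∧ x.2 ≤ hi := fun x => by
    rw [hnn, hv1, hv0]; exact mem_segment_vertical (by linarith)
  have elt : ∀ j < n - 1, segment ℝ (v' j) (v' (j + 1)) = segment ℝ (v j) (v (j + 1)) :=
    fun j hj => by rw [vlt _ (by omega), vlt _ (by omega)]
  have e0 : ∀ x, x ∈ segment ℝ (v' (n - 1)) (v' (n - 1 + 1)) ↔
      x.1 = 0 ∧ -lo ≤ x.2 ∧ x.2 ≤ -(k * h) := fun x => by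
    rw [hnn, vpred, vn]; exact mem_segment_vertical (by linarith)
  have e1 : ∀ x, x ∈ segment ℝ (v' n) (v' (n + 1)) ↔
      -h ≤ x.1 ∧ x.1 ≤ 0 ∧ x.2 = 0 + (-k) * (x.1 - -h) := fun x => by
    rw [segment_symm, vn, vn1]; exact mem_segment_of_slope (by linarith) (by ring)
  have e2 : ∀ x, x ∈ segment ℝ (v' (n + 1)) (v' (n + 1 + 1)) ↔
      -h ≤ x.1 ∧ x.1 ≤ 0 ∧ x.2 = 0 + k * (x.1 - -h) := fun x => by
    rw [vn1, vn2]; exact mem_segment_of_slope (by linarith) (by ring)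
  have e3 : ∀ x, x ∈ segment ℝ (v' (n + 2)) (v' (n + 2 + 1)) ↔
      x.1 = 0 ∧ k * h ≤ x.2 ∧ x.2 ≤ hi := fun x => by
    rw [vn2, vn3]; exact mem_segment_vertical (by linarith)
  have abs1 : ∀ x, x ∈ segment ℝ (v' n) (v' (n + 1)) → |x.2| = k * (x.1 + h) := fun x hx => by
    obtain ⟨h1, h2, h3⟩ := (e1 x).1 hx
    rw [h3, abs_of_nonpos] <;> nlinarith
  have abs2 : ∀ x, x ∈ segment ℝ (v' (n + 1)) (v' (n + 1 + 1)) → |x.2| = k * (x.1 + h) :=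
    fun x hx => by
      obtain ⟨h1, h2, h3⟩ := (e2 x).1 hx
      rw [h3, abs_of_nonneg] <;> nlinarith
  have fr_of : ∀ j < n, ∀ x ∈ segment ℝ (v j) (v (j + 1)), x ∈ closure C ∧ x ∉ C := by
    intro j hj x hx
    have : x ∈ frontier C := by rw [hC.frontier_eq, mem_chainSet]; exact ⟨j, hj, hx⟩
    rwa [hfr] at this
  -- an old edge other than the last one meets the last one only in its ends
  have far : ∀ j < n - 1, ∀ x ∈ segment ℝ (v j) (v (j + 1)), x.1 = 0 → -lo ≤ x.2 → x.2 ≤ hi →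
      (x = v j ∨ x = v (j + 1)) ∧ (x = (0, -lo) ∨ x = (0, hi)) := by
    intro j hj x hx h1 h2 h3
    have := hC.chain.inter j (n - 1) hj (by omega) ⟨hx, (eold x).2 ⟨h1, h2, h3⟩⟩
    rw [hnn, hv1, hv0] at this
    exact this
  have avoid : ∀ j < n - 1, ∀ x ∈ segment ℝ (v j) (v (j + 1)), x.1 ≤ 0 →
      ¬ |x.2| ≤ k * (x.1 + h) := by
    intro j hj x hx h1 h2
    rcases h1.lt_or_eq with h3 | h3
    · exact hout x h3 h2 (fr_of j (by omega) x hx).1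
    · rw [h3, zero_add, abs_le] at h2
      rcases (far j hj x hx h3 (by linarith) (by linarith)).2 with rfl | rfl <;>
        dsimp only at h2 <;> linarith
  have vedge : ∀ j < n, ∃ i < n - 1, v j ∈ segment ℝ (v i) (v (i + 1)) := by
    intro j hj
    rcases eq_or_ne j (n - 1) with rfl | h1
    · refine ⟨n - 2, by omega, ?_⟩
      rw [show n - 2 + 1 = n - 1 by omega]
      exact right_mem_segment ℝ _ _
    · exact ⟨j, by omega, left_mem_segment ℝ _ _⟩
  have vne : ∀ j < n, ∀ y : ℝ × ℝ, y.1 ≤ 0 → |y.2| ≤ k * (y.1 + h) → v j ≠ y := by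
    rintro j hj y h1 h2 rfl
    obtain ⟨i, hi, hx⟩ := vedge j hj
    exact avoid i hi _ hx h1 h2
  have vne0 : ∀ j < n, v j ≠ (0, -(k * h)) := fun j hj =>
    vne j hj _ le_rfl (by simp [abs_of_pos hkh])
  have vne1 : ∀ j < n, v j ≠ (-h, 0) := fun j hj =>
    vne j hj _ (by dsimp only; linarith) (by simp)
  have vne2 : ∀ j < n, v j ≠ (0, k * h) := fun j hj =>
    vne j hj _ le_rfl (by simp [abs_of_pos hkh])
  have hedge : ∀ x, x ∈ chainSet (n + 3) v' ↔
      (∃ j < n - 1, x ∈ segment ℝ (v j) (v (j + 1))) ∨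
        x ∈ segment ℝ (v' (n - 1)) (v' (n - 1 + 1)) ∨ x ∈ segment ℝ (v' n) (v' (n + 1)) ∨
        x ∈ segment ℝ (v' (n + 1)) (v' (n + 1 + 1)) ∨
        x ∈ segment ℝ (v' (n + 2)) (v' (n + 2 + 1)) := by
    intro x
    rw [mem_chainSet]
    constructor
    · rintro ⟨j, hj, hx⟩
      have : j < n - 1 ∨ j = n - 1 ∨ j = n ∨ j = n + 1 ∨ j = n + 2 := by omega
      rcases this with h1 | rfl | rfl | rfl | rfl
      · rw [elt j h1] at hx
        exact Or.inl ⟨j, h1, hx⟩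
      all_goals tauto
    · rintro (⟨j, hj, hx⟩ | hx | hx | hx | hx)
      · exact ⟨j, by omega, by rwa [elt j hj]⟩
      · exact ⟨_, by omega, hx⟩
      · exact ⟨_, by omega, hx⟩
      · exact ⟨_, by omega, hx⟩
      · exact ⟨_, by omega, hx⟩
  refine ⟨v', hC.isOpen.union isOpen_spike, ?_, hC.isBounded.union (isBounded_spike hk),
    ⟨by omega, ?_, ?_, ?_⟩, ?_⟩
  · refine IsConnected.union ⟨(η / 2, 0), ?_, ?_⟩ hC.isConnected
      ⟨spike_nonempty hh hη hk, convex_spike.isPreconnected⟩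
    · refine hin _ (by simpa using hη) (by dsimp only; linarith) ?_
      simp only [abs_zero]
      positivity
    · refine ⟨by dsimp only; linarith, ?_⟩
      simp only [abs_zero]
      positivity
  · rw [vn3, vlt 0 (by omega), ← hC.chain.closed, hv0]
  · have key : ∀ a b, a < b → b < n + 3 → v' a ≠ v' b := by
      intro a b hab hb
      have hb' : b < n ∨ b = n ∨ b = n + 1 ∨ b = n + 2 := by omega
      rcases lt_or_ge a n with ha | ha
      · rw [vlt a ha]
        rcases hb' with h1 | rfl | rfl | rfl
        · rw [vlt b h1]
          exact fun h2 => hab.ne (hC.chain.inj a ha b h1 h2)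
        · rw [vn]; exact vne0 a ha
        · rw [vn1]; exact vne1 a ha
        · rw [vn2]; exact vne2 a ha
      · have : (a = n ∧ b = n + 1) ∨ (a = n ∧ b = n + 2) ∨ (a = n + 1 ∧ b = n + 2) := by omega
        rcases this with ⟨rfl, rfl⟩ | ⟨rfl, rfl⟩ | ⟨rfl, rfl⟩
        · rw [vn, vn1]; intro h2; have := congrArg Prod.fst h2; dsimp only at this; linarith
        · rw [vn, vn2]; intro h2; have := congrArg Prod.snd h2; dsimp only at this; linarith
        · rw [vn1, vn2]; intro h2; have := congrArg Prod.fst h2; dsimp only at this; linarith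
    intro a ha b hb hab
    rcases lt_trichotomy a b with h1 | h1 | h1
    · exact absurd hab (key a b h1 hb)
    · exact h1
    · exact absurd hab.symm (key b a h1 ha)
  · rintro a b hab hb x ⟨hxa, hxb⟩
    have hb' : b < n - 1 ∨ b = n - 1 ∨ b = n ∨ b = n + 1 ∨ b = n + 2 := by omega
    rcases lt_or_ge a (n - 1) with ha | ha
    · rw [elt a ha] at hxa
      rw [vlt a (by omega), vlt (a + 1) (by omega)]
      rcases hb' with h1 | rfl | rfl | rfl | rfl
      · rw [elt b h1] at hxb
        rw [vlt b (by omega), vlt (b + 1) (by omega)]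
        exact hC.chain.inter a b hab (by omega) ⟨hxa, hxb⟩
      · obtain ⟨h1, h2, h3⟩ := (e0 x).1 hxb
        obtain ⟨h4, h5⟩ := far a ha x hxa h1 h2 (by linarith)
        refine ⟨h4, Or.inl ?_⟩
        rw [vpred]
        refine h5.resolve_right ?_
        rintro rfl
        dsimp only at h3
        linarith
      · exact (avoid a ha x hxa ((e1 x).1 hxb).2.1 (abs1 x hxb).le).elim
      · exact (avoid a ha x hxa ((e2 x).1 hxb).2.1 (abs2 x hxb).le).elim
      · obtain ⟨h1, h2, h3⟩ := (e3 x).1 hxb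
        obtain ⟨h4, h5⟩ := far a ha x hxa h1 (by linarith) h3
        refine ⟨h4, Or.inr ?_⟩
        rw [vn3]
        refine h5.resolve_left ?_
        rintro rfl
        dsimp only at h2
        linarith
    · have : (a = n - 1 ∧ b = n) ∨ (a = n - 1 ∧ b = n + 1) ∨ (a = n - 1 ∧ b = n + 2) ∨
          (a = n ∧ b = n + 1) ∨ (a = n ∧ b = n + 2) ∨ (a = n + 1 ∧ b = n + 2) := by omega
      rcases this with ⟨rfl, rfl⟩ | ⟨rfl, rfl⟩ | ⟨rfl, rfl⟩ | ⟨rfl, rfl⟩ | ⟨rfl, rfl⟩ | ⟨rfl, rfl⟩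
      · have h1 := (e0 x).1 hxa
        have h2 := (e1 x).1 hxb
        have : x = v' b := by
          rw [vn]; exact Prod.ext h1.1 (by rw [h2.2.2, h1.1]; ring)
        rw [hnn, this]
        simp
      · have h1 := (e0 x).1 hxa
        have h2 := (e2 x).1 hxb
        rw [h1.1] at h2
        exfalso; linarith
      · have h1 := (e0 x).1 hxa
        have h2 := (e3 x).1 hxb
        exfalso; linarith
      · have h1 := (e1 x).1 hxa
        have h2 := (e2 x).1 hxb
        have h3 : k * (x.1 + h) = 0 := by linarith
        have h4 : x.1 + h = 0 := (mul_eq_zero.1 h3).resolve_left hk.ne'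
        have : x = v' (a + 1) := by
          rw [vn1]; exact Prod.ext (by dsimp only; linarith) (by rw [h1.2.2]; dsimp only; linarith)
        rw [this]
        simp
      · have h1 := (e1 x).1 hxa
        have h2 := (e3 x).1 hxb
        rw [h2.1] at h1
        exfalso; linarith
      · have h1 := (e2 x).1 hxa
        have h2 := (e3 x).1 hxb
        have : x = v' (n + 2) := by
          rw [vn2]; exact Prod.ext h2.1 (by rw [h1.2.2, h2.1]; ring)
        rw [this]
        simp
  · rw [(hC.isOpen.union isOpen_spike).frontier_eq, closure_union, closure_spike hh hη hk]
    ext x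
    rw [hedge]
    constructor
    · rintro ⟨hx, hx'⟩
      rw [Set.mem_union, not_or] at hx'
      obtain ⟨hxC, hxS⟩ := hx'
      rcases hx with hx | ⟨h1, h2⟩
      · have : x ∈ frontier C := by rw [hfr]; exact ⟨hx, hxC⟩
        rw [hC.frontier_eq, mem_chainSet] at this
        obtain ⟨j, hj, hxj⟩ := this
        rcases eq_or_ne j (n - 1) with rfl | hj'
        · obtain ⟨h1, h2, h3⟩ := (eold x).1 hxj
          have h4 : k * h ≤ |x.2| := by
            refine not_lt.1 fun h4 => hxS ⟨by rw [h1]; exact hη, ?_⟩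
            rwa [h1, zero_add]
          rcases le_abs.1 h4 with h5 | h5
          · exact Or.inr (Or.inr (Or.inr (Or.inr ((e3 x).2 ⟨h1, h5, h3⟩))))
          · exact Or.inr (Or.inl ((e0 x).2 ⟨h1, h2, by linarith⟩))
        · exact Or.inl ⟨j, by omega, hxj⟩
      · have h3 : x.1 ≤ 0 := not_lt.1 fun h3 => hxC (hin x h3 h1 h2)
        have h0 : 0 ≤ x.1 + h := (mul_nonneg_iff_of_pos_left hk).1 ((abs_nonneg _).trans h2)
        have h5 : |x.2| = k * (x.1 + h) :=
          le_antisymm h2 (not_lt.1 fun h5 => hxS ⟨by linarith, h5⟩)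
        rcases abs_choice x.2 with h6 | h6
        · exact Or.inr (Or.inr (Or.inr (Or.inl ((e2 x).2 ⟨by linarith, h3, by linarith⟩))))
        · exact Or.inr (Or.inr (Or.inl ((e1 x).2 ⟨by linarith, h3, by linarith⟩)))
    · have side : ∀ y : ℝ × ℝ, y.1 ≤ 0 → |y.2| = k * (y.1 + h) →
          y ∈ (closure C ∪ {x | x.1 ≤ η ∧ |x.2| ≤ k * (x.1 + h)}) \ (C ∪ spike h η k) := by
        intro y h1 h2
        refine ⟨Or.inr ⟨by linarith, h2.le⟩, ?_⟩
        rintro (h3 | h3)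
        · rcases h1.lt_or_eq with h4 | h4
          · exact hout y h4 h2.le (subset_closure h3)
          · rw [h4, zero_add] at h2
            have := abs_le.1 h2.le
            exact (fr_of (n - 1) (by omega) y
              ((eold y).2 ⟨h4, by linarith, by linarith⟩)).2 h3
        · exact h3.2.ne h2
      have base : ∀ y : ℝ × ℝ, y.1 = 0 → -lo ≤ y.2 → y.2 ≤ hi → k * h ≤ |y.2| →
          y ∈ (closure C ∪ {x | x.1 ≤ η ∧ |x.2| ≤ k * (x.1 + h)}) \ (C ∪ spike h η k) := by
        intro y h1 h2 h3 h4
        obtain ⟨h5, h6⟩ := fr_of (n - 1) (by omega) y ((eold y).2 ⟨h1, h2, h3⟩)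
        refine ⟨Or.inl h5, ?_⟩
        rintro (h7 | h7)
        · exact h6 h7
        · have := h7.2
          rw [h1, zero_add] at this
          linarith
      rintro (⟨j, hj, hx⟩ | hx | hx | hx | hx)
      · obtain ⟨h1, h2⟩ := fr_of j (by omega) x hx
        refine ⟨Or.inl h1, ?_⟩
        rintro (h3 | h3)
        · exact h2 h3
        · rcases lt_or_ge 0 x.1 with h4 | h4
          · exact h2 (hin x h4 h3.1.le h3.2.le)
          · exact avoid j hj x hx h4 h3.2.le
      · obtain ⟨h1, h2, h3⟩ := (e0 x).1 hx
        exact base x h1 h2 (by linarith) (le_abs.2 (Or.inr (by linarith)))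
      · exact side x ((e1 x).1 hx).2.1 (abs1 x hx)
      · exact side x ((e2 x).1 hx).2.1 (abs2 x hx)
      · obtain ⟨h1, h2, h3⟩ := (e3 x).1 hx
        exact base x h1 (by linarith) h3 (le_abs.2 (Or.inl h2))

end AddSpike

section Extend

open Set Topology

theorem IsPreconnected.subset_interior_or_subset_compl_closure {X : Type*} [TopologicalSpace X]
    {s C : Set X} (hs : IsPreconnected s) (hd : Disjoint s (frontier C)) :
    s ⊆ interior C ∨ s ⊆ (closure C)ᶜ := by
  refine hs.subset_or_subset isOpen_interior isClosed_closure.isOpen_compl ?_ ?_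
  · exact disjoint_compl_right.mono_left (interior_subset.trans subset_closure)
  · intro x hx
    by_cases h : x ∈ closure C
    · exact Or.inl (by_contra fun h' => hd.notMem_of_mem_left hx ⟨h, h'⟩)
    · exact Or.inr h

theorem IsChainRegion.exists_half_boxes {n : ℕ} {v : ℕ → ℝ × ℝ} {C : Set (ℝ × ℝ)}
    (hC : IsChainRegion n v C) {lo hi t₀ : ℝ} (hlo : 0 < lo) (hhi : 0 < hi)
    (hv1 : v (n - 1) = (0, -lo)) (hv0 : v n = (0, hi)) (ht₀ : 0 < t₀)
    (hout : ∀ t, -t₀ ≤ t → t < 0 → ((t, 0) : ℝ × ℝ) ∉ closure C) :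
    ∃ ε > 0, (∀ x : ℝ × ℝ, 0 < x.1 → x.1 < ε → |x.2| < ε → x ∈ C) ∧
      ∀ x : ℝ × ℝ, x.1 < 0 → -ε < x.1 → |x.2| < ε → x ∉ closure C := by
  have hn := hC.chain.three_le
  have hlast : ∀ x : ℝ × ℝ, x.1 = 0 → -lo ≤ x.2 → x.2 ≤ hi →
      x ∈ segment ℝ (v (n - 1)) (v (n - 1 + 1)) := by
    intro x h1 h2 h3
    rw [show n - 1 + 1 = n by omega, hv1, hv0]
    exact (mem_segment_vertical (by linarith)).2 ⟨h1, h2, h3⟩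
  have hlastfr : ∀ x : ℝ × ℝ, x.1 = 0 → -lo ≤ x.2 → x.2 ≤ hi → x ∈ frontier C := by
    intro x h1 h2 h3
    rw [hC.frontier_eq, mem_chainSet]
    exact ⟨n - 1, by omega, hlast x h1 h2 h3⟩
  have hclosed : IsClosed (⋃ j < n - 1, segment ℝ (v j) (v (j + 1))) := by
    refine (Set.finite_lt_nat (n - 1)).isClosed_biUnion fun j _ => ?_
    rw [segment_eq_image_lineMap]
    exact (isCompact_Icc.image AffineMap.lineMap_continuous).isClosed
  have h0 : (0 : ℝ × ℝ) ∈ (⋃ j < n - 1, segment ℝ (v j) (v (j + 1)))ᶜ := by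
    simp only [mem_compl_iff, mem_iUnion, not_exists]
    intro j hj hx
    have h1 := hC.chain.inter j (n - 1) hj (by omega)
      ⟨hx, hlast 0 rfl (by simpa using hlo.le) (by simpa using hhi.le)⟩
    rw [show n - 1 + 1 = n by omega, hv1, hv0] at h1
    rcases h1.2 with h2 | h2 <;> have h3 := congrArg Prod.snd h2 <;> simp at h3 <;> linarith
  obtain ⟨ε', hε', hball⟩ := Metric.isOpen_iff.1 hclosed.isOpen_compl 0 h0
  set ε := min ε' (min lo hi) with hεdef
  have hε : 0 < ε := lt_min hε' (lt_min hlo hhi)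
  have hεlo : ε ≤ lo := (min_le_right _ _).trans (min_le_left _ _)
  have hεhi : ε ≤ hi := (min_le_right _ _).trans (min_le_right _ _)
  have hbox : ∀ x : ℝ × ℝ, |x.1| < ε → |x.2| < ε → x ∈ frontier C → x.1 = 0 := by
    intro x h1 h2 h3
    have h4 : x ∈ Metric.ball (0 : ℝ × ℝ) ε' := by
      rw [mem_ball_zero_iff, Prod.norm_def, Real.norm_eq_abs, Real.norm_eq_abs]
      exact (max_lt h1 h2).trans_le (min_le_left _ _)
    have h5 := hball h4
    simp only [mem_compl_iff, mem_iUnion, not_exists] at h5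
    rw [hC.frontier_eq, mem_chainSet] at h3
    obtain ⟨j, hj, hx⟩ := h3
    rcases eq_or_ne j (n - 1) with rfl | hj'
    · rw [show n - 1 + 1 = n by omega, hv1, hv0, mem_segment_vertical (by linarith)] at hx
      exact hx.1
    · exact (h5 j (by omega) hx).elim
  have hneg : Ioo (-ε) 0 ×ˢ Ioo (-ε) ε ⊆ (closure C)ᶜ := by
    have hd : Disjoint (Ioo (-ε) 0 ×ˢ Ioo (-ε) ε) (frontier C) := by
      refine Set.disjoint_left.2 fun x hx hx' => hx.1.2.ne ?_
      exact hbox x (abs_lt.2 ⟨hx.1.1, hx.1.2.trans hε⟩) (abs_lt.2 hx.2) hx'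
    refine ((isPreconnected_Ioo.prod isPreconnected_Ioo).subset_interior_or_subset_compl_closure
      hd).resolve_left fun h => ?_
    have hm : 0 < min (ε / 2) t₀ := lt_min (half_pos hε) ht₀
    have hm' : min (ε / 2) t₀ < ε := (min_le_left _ _).trans_lt (half_lt_self hε)
    have hx : ((-min (ε / 2) t₀, 0) : ℝ × ℝ) ∈ Ioo (-ε) 0 ×ˢ Ioo (-ε) ε :=
      ⟨⟨by dsimp only; linarith, by dsimp only; linarith⟩, ⟨by dsimp only; linarith, hε⟩⟩
    exact hout _ (neg_le_neg (min_le_right _ _)) (by linarith)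
      (subset_closure (interior_subset (h hx)))
  have hpos : Ioo 0 ε ×ˢ Ioo (-ε) ε ⊆ C := by
    have hd : Disjoint (Ioo 0 ε ×ˢ Ioo (-ε) ε) (frontier C) := by
      refine Set.disjoint_left.2 fun x hx hx' => hx.1.1.ne' ?_
      exact hbox x (abs_lt.2 ⟨by linarith [hx.1.1], hx.1.2⟩) (abs_lt.2 hx.2) hx'
    refine ((isPreconnected_Ioo.prod isPreconnected_Ioo).subset_interior_or_subset_compl_closure
      hd).elim (fun h => h.trans interior_subset) fun h => ?_
    exfalso
    have h1 : (0 : ℝ × ℝ) ∈ closure C :=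
      (hlastfr 0 rfl (by simpa using hlo.le) (by simpa using hhi.le)).1
    obtain ⟨y, hyC, hy⟩ := Metric.mem_closure_iff.1 h1 ε hε
    rw [dist_zero_left, Prod.norm_def, max_lt_iff, Real.norm_eq_abs, Real.norm_eq_abs, abs_lt,
      abs_lt] at hy
    rcases lt_trichotomy y.1 0 with h2 | h2 | h2
    · exact hneg (show y ∈ _ from ⟨⟨hy.1.1, h2⟩, hy.2⟩) (subset_closure hyC)
    · have := hlastfr y h2 (by linarith) (by linarith)
      rw [hC.isOpen.frontier_eq] at this
      exact this.2 hyC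
    · exact h (show y ∈ _ from ⟨⟨h2, hy.1.2⟩, hy.2⟩) (subset_closure hyC)
  refine ⟨ε, hε, fun x h1 h2 h3 => hpos ⟨⟨h1, h2⟩, abs_lt.1 h3⟩,
    fun x h1 h2 h3 => hneg ⟨⟨h2, h1⟩, abs_lt.1 h3⟩⟩

theorem IsChainRegion.exists_extend_of_coord {n : ℕ} {v : ℕ → ℝ × ℝ} {C U : Set (ℝ × ℝ)}
    (hC : IsChainRegion n v C) (hU : IsOpen U) (hCU : closure C ⊆ U) {lo hi t₀ : ℝ} (hlo : 0 < lo)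
    (hhi : 0 < hi) (hv1 : v (n - 1) = (0, -lo)) (hv0 : v n = (0, hi)) (ht₀ : 0 < t₀)
    (hout : ∀ t, -t₀ ≤ t → t < 0 → ((t, 0) : ℝ × ℝ) ∉ closure C)
    (hseg : ∀ t, -t₀ ≤ t → t ≤ 0 → ((t, 0) : ℝ × ℝ) ∈ U) :
    ∃ C', (∃ n v, IsChainRegion n v C') ∧ closure C' ⊆ U ∧ C ⊆ C' ∧
      ((-t₀, 0) : ℝ × ℝ) ∈ C' := by
  obtain ⟨ε, hε, hpos, hneg⟩ := hC.exists_half_boxes hlo hhi hv1 hv0 ht₀ hout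
  have hW : IsOpen ((U ∩ (Ioo (-ε) ε ×ˢ Ioo (-ε) ε)) ∪
      (U ∩ ({x | x.1 < 0} ∩ (closure C)ᶜ))) := by
    have h1 : IsOpen {x : ℝ × ℝ | x.1 < 0} := isOpen_lt (by fun_prop) (by fun_prop)
    exact (hU.inter (isOpen_Ioo.prod isOpen_Ioo)).union
      (hU.inter (h1.inter isClosed_closure.isOpen_compl))
  have hcore : Icc (-t₀) 0 ×ˢ {0} ⊆ ((U ∩ (Ioo (-ε) ε ×ˢ Ioo (-ε) ε)) ∪
      (U ∩ ({x | x.1 < 0} ∩ (closure C)ᶜ))) := by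
    rintro ⟨t, y⟩ ⟨ht, hy⟩
    obtain rfl : y = 0 := hy
    rcases ht.2.lt_or_eq with h1 | h1
    · exact Or.inr ⟨hseg t ht.1 ht.2, h1, hout t ht.1 h1⟩
    · refine Or.inl ⟨hseg t ht.1 ht.2, ?_⟩
      dsimp only at h1
      rw [h1]
      exact ⟨⟨by simpa using hε, hε⟩, ⟨by simpa using hε, hε⟩⟩
  obtain ⟨V, V', hV, hV', hsV, hsV', hVW⟩ :=
    generalized_tube_lemma isCompact_Icc isCompact_singleton hW hcore
  obtain ⟨r₁, hr₁, hb₁⟩ := Metric.isOpen_iff.1 hV (-t₀) (hsV ⟨le_rfl, by linarith⟩)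
  obtain ⟨r₂, hr₂, hb₂⟩ := Metric.isOpen_iff.1 hV 0 (hsV ⟨by linarith, le_rfl⟩)
  obtain ⟨r₃, hr₃, hb₃⟩ := Metric.isOpen_iff.1 hV' 0 (hsV' rfl)
  obtain ⟨η, hη, hη'⟩ := exists_between (lt_min hr₁ hr₂)
  obtain ⟨δ, hδ, hδ'⟩ := exists_between (lt_min hr₃ (lt_min hlo hhi))
  simp only [lt_min_iff] at hη' hδ'
  set h := t₀ + η with hh
  have hηh : 0 < η + h := by linarith
  set k := δ / (η + h) with hk
  have hk0 : 0 < k := div_pos hδ hηh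
  have hkδ : k * (η + h) = δ := div_mul_cancel₀ _ hηh.ne'
  have hkh : k * h ≤ δ := by nlinarith
  have hmem : ∀ x : ℝ × ℝ, x.1 ≤ η → |x.2| ≤ k * (x.1 + h) →
      x ∈ U ∧ (x.1 < 0 → x ∉ closure C) ∧ (0 < x.1 → x ∈ C) := by
    intro x h1 h2
    have h3 : 0 ≤ x.1 + h := (mul_nonneg_iff_of_pos_left hk0).1 ((abs_nonneg _).trans h2)
    have h4 : x.1 ∈ V := by
      rcases lt_or_ge x.1 (-t₀) with h5 | h5
      · refine hb₁ ?_
        rw [Metric.mem_ball, Real.dist_eq, abs_lt]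
        constructor <;> linarith
      rcases le_or_gt x.1 0 with h6 | h6
      · exact hsV ⟨h5, h6⟩
      · refine hb₂ ?_
        rw [Metric.mem_ball, Real.dist_eq, abs_lt]
        constructor <;> linarith
    have h5 : x.2 ∈ V' := by
      refine hb₃ ?_
      rw [Metric.mem_ball, Real.dist_eq, sub_zero]
      nlinarith
    rcases hVW (show x ∈ V ×ˢ V' from ⟨h4, h5⟩) with ⟨h6, h7⟩ | ⟨h6, h7⟩
    · exact ⟨h6, fun h8 => hneg x h8 h7.1.1 (abs_lt.2 h7.2),
        fun h8 => hpos x h8 h7.1.2 (abs_lt.2 h7.2)⟩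
    · exact ⟨h6, fun _ => h7.2, fun h8 => absurd h7.1 h8.le.not_gt⟩
  obtain ⟨v', hv'⟩ := hC.union_spike (h := h) (η := η) (k := k) (by linarith) hη hk0
    (by linarith) (by linarith) hv1 hv0 (fun x h1 h2 h3 => (hmem x h2 h3).2.2 h1)
    (fun x h1 h2 => (hmem x (by linarith) h2).2.1 h1)
  refine ⟨_, ⟨_, v', hv'⟩, ?_, subset_union_left, Or.inr ⟨by dsimp only; linarith, ?_⟩⟩
  · rw [closure_union, closure_spike (by linarith) hη hk0]
    exact union_subset hCU fun x hx => (hmem x hx.1 hx.2).1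
  · simp only [abs_zero]
    exact mul_pos hk0 (by linarith)

/-- Affine coordinates of the plane with origin `p` and axes `u`, `d`. -/
theorem exists_affine_coordinates (p u d : ℝ × ℝ) (h : u.1 * d.2 - u.2 * d.1 ≠ 0) :
    ∃ e : (ℝ × ℝ) ≃ᴬ[ℝ] (ℝ × ℝ), ∀ a b : ℝ, e (a, b) = p + (a • u + b • d) := by
  let f : (ℝ × ℝ) →ₗ[ℝ] (ℝ × ℝ) :=
    (LinearMap.fst ℝ ℝ ℝ).smulRight u + (LinearMap.snd ℝ ℝ ℝ).smulRight d
  have hf : Function.Injective f := by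
    rw [← LinearMap.ker_eq_bot, LinearMap.ker_eq_bot']
    rintro ⟨a, b⟩ hab
    have h1 : a * u.1 + b * d.1 = 0 := by simpa [f] using congrArg Prod.fst hab
    have h2 : a * u.2 + b * d.2 = 0 := by simpa [f] using congrArg Prod.snd hab
    have h3 : a * (u.1 * d.2 - u.2 * d.1) = 0 := by linear_combination d.2 * h1 - d.1 * h2
    have h4 : b * (u.1 * d.2 - u.2 * d.1) = 0 := by linear_combination u.1 * h2 - u.2 * h1
    exact Prod.ext ((mul_eq_zero.1 h3).resolve_right h) ((mul_eq_zero.1 h4).resolve_right h)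
  exact ⟨(f.linearEquivOfInjective hf rfl).toContinuousLinearEquiv.toContinuousAffineEquiv.trans
    (ContinuousAffineEquiv.constVAdd ℝ _ p), fun a b => rfl⟩

theorem dense_cross_ne_zero (z : ℝ × ℝ) {w : ℝ × ℝ} (hw : w ≠ 0) :
    Dense {x : ℝ × ℝ | (x - z).1 * w.2 - (x - z).2 * w.1 ≠ 0} := by
  intro x
  have hw' : w.2 * w.2 + w.1 * w.1 ≠ 0 := by
    intro h
    have h1 : w.1 = 0 := by nlinarith [mul_self_nonneg w.1, mul_self_nonneg w.2]
    have h2 : w.2 = 0 := by nlinarith [mul_self_nonneg w.1, mul_self_nonneg w.2]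
    exact hw (Prod.ext h1 h2)
  by_cases hx : (x - z).1 * w.2 - (x - z).2 * w.1 = 0
  · have ht : Filter.Tendsto (fun t : ℝ => x + t • ((w.2, -w.1) : ℝ × ℝ)) (𝓝[≠] 0) (𝓝 x) := by
      have : Continuous fun t : ℝ => x + t • ((w.2, -w.1) : ℝ × ℝ) := by fun_prop
      simpa using (this.tendsto 0).mono_left nhdsWithin_le_nhds
    refine mem_closure_of_tendsto ht ?_
    filter_upwards [self_mem_nhdsWithin] with t ht
    have : (x + t • ((w.2, -w.1) : ℝ × ℝ) - z).1 * w.2 -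
        (x + t • ((w.2, -w.1) : ℝ × ℝ) - z).2 * w.1 = t * (w.2 * w.2 + w.1 * w.1) := by
      simp only [Prod.fst_sub, Prod.snd_sub, Prod.fst_add, Prod.snd_add, Prod.smul_mk,
        smul_eq_mul] at hx ⊢
      linear_combination hx
    show _ ≠ _
    rw [this]
    exact mul_ne_zero ht hw'
  · exact subset_closure hx

theorem IsChainRegion.exists_generic {n : ℕ} {v : ℕ → ℝ × ℝ} {C U : Set (ℝ × ℝ)}
    (hC : IsChainRegion n v C) (hU : IsOpen U) {z a : ℝ × ℝ} (hz : z ∉ closure C) (ha : a ∈ C)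
    (hseg : segment ℝ z a ⊆ U) : ∃ b ∈ C, (∀ t ∈ Icc (0 : ℝ) 1, z + t • (b - z) ∈ U) ∧
      ∀ j < n, (b - z).1 * (v j - z).2 - (b - z).2 * (v j - z).1 ≠ 0 := by
  have hW : IsOpen ((fun q : ℝ × (ℝ × ℝ) => z + q.1 • (q.2 - z)) ⁻¹' U) :=
    hU.preimage (by fun_prop)
  have hsub : Icc (0 : ℝ) 1 ×ˢ {a} ⊆ (fun q : ℝ × (ℝ × ℝ) => z + q.1 • (q.2 - z)) ⁻¹' U := by
    rintro ⟨t, b⟩ ⟨ht, rfl⟩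
    refine hseg ?_
    rw [segment_eq_image']
    exact ⟨t, ht, rfl⟩
  obtain ⟨V, V', -, hV', hsV, hsV', hVW⟩ :=
    generalized_tube_lemma isCompact_Icc isCompact_singleton hW hsub
  have hvz : ∀ j : Fin n, v j - z ≠ 0 := by
    intro j h
    rw [sub_eq_zero] at h
    have h1 : v j ∈ frontier C := by
      rw [hC.frontier_eq, mem_chainSet]
      exact ⟨j, j.2, left_mem_segment ℝ _ _⟩
    exact hz (h ▸ h1.1)
  have hdense : Dense (⋂ j : Fin n, {x : ℝ × ℝ |
      (x - z).1 * (v j - z).2 - (x - z).2 * (v j - z).1 ≠ 0}) := by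
    refine dense_iInter_of_isOpen (fun j => ?_) fun j => dense_cross_ne_zero z (hvz j)
    exact isOpen_ne_fun (by fun_prop) (by fun_prop)
  obtain ⟨b, hb, hb'⟩ := hdense.inter_open_nonempty (C ∩ V') (hC.isOpen.inter hV')
    ⟨a, ha, hsV' rfl⟩
  refine ⟨b, hb.1, fun t ht => hVW (show (t, b) ∈ V ×ˢ V' from ⟨hsV ht, hb.2⟩), fun j hj => ?_⟩
  exact mem_iInter.1 hb' ⟨j, hj⟩

theorem exists_extend {C U : Set (ℝ × ℝ)} (hC : ∃ n v, IsChainRegion n v C) (hU : IsOpen U)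
    (hCU : closure C ⊆ U) {z a : ℝ × ℝ} (hz : z ∉ closure C) (ha : a ∈ C)
    (hseg : segment ℝ z a ⊆ U) :
    ∃ C', (∃ n v, IsChainRegion n v C') ∧ closure C' ⊆ U ∧ C ⊆ C' ∧ z ∈ C' := by
  obtain ⟨n, v, hC⟩ := hC
  obtain ⟨b, hb, hbU, hbv⟩ := hC.exists_generic hU hz ha hseg
  have hcont : Continuous fun t : ℝ => z + t • (b - z) := by fun_prop
  have hK : IsCompact (Icc (0 : ℝ) 1 ∩ (fun t : ℝ => z + t • (b - z)) ⁻¹' closure C) :=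
    isCompact_Icc.inter_right (isClosed_closure.preimage hcont)
  obtain ⟨t₀, ⟨ht₀, hp⟩, hleast⟩ := hK.exists_isLeast
    ⟨1, ⟨zero_le_one, le_rfl⟩, by simpa using subset_closure hb⟩
  have hpos : 0 < t₀ := by
    refine ht₀.1.lt_of_ne ?_
    rintro rfl
    exact hz (by simpa using hp)
  have hpC : z + t₀ • (b - z) ∉ C := by
    intro h
    have h1 : ∀ᶠ t in 𝓝[<] t₀, z + t • (b - z) ∈ C :=
      (hcont.tendsto t₀).mono_left nhdsWithin_le_nhds (hC.isOpen.mem_nhds h)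
    have h2 : ∀ᶠ t in 𝓝[<] t₀, t ∈ Ioo 0 t₀ := Ioo_mem_nhdsLT hpos
    obtain ⟨t, h3, h4⟩ := (h1.and h2).exists
    exact (hleast ⟨⟨h4.1.le, h4.2.le.trans ht₀.2⟩, subset_closure h3⟩).not_gt h4.2
  set p := z + t₀ • (b - z) with hpdef
  set u := b - z with hu
  have hpf : p ∈ chainSet n v := by
    rw [← hC.frontier_eq, hC.isOpen.frontier_eq]
    exact ⟨hp, hpC⟩
  obtain ⟨i, hi, hpi⟩ := mem_chainSet.1 hpf
  obtain ⟨v', hv', hset, hvi, hvi'⟩ := hC.chain.exists_rotate hi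
  have hC' : IsChainRegion n v' C :=
    ⟨hC.isOpen, hC.isConnected, hC.isBounded, hv', by rw [hset, hC.frontier_eq]⟩
  have hcross₀ := hbv i hi
  have hcross₁ : u.1 * (v (i + 1) - z).2 - u.2 * (v (i + 1) - z).1 ≠ 0 := by
    rcases eq_or_ne (i + 1) n with h | h
    · rw [h, hC.chain.closed]
      exact hbv 0 (by omega)
    · exact hbv (i + 1) (by omega)
  obtain ⟨s, hs0, hs1, hps1, hps2⟩ := mem_segment_prod_iff.1 hpi
  set d := v (i + 1) - v i with hd
  have hz1 : z.1 = p.1 - t₀ * u.1 := by simp [hpdef]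
  have hz2 : z.2 = p.2 - t₀ * u.2 := by simp [hpdef]
  have hd1 : d.1 = (v (i + 1)).1 - (v i).1 := by simp [hd]
  have hd2 : d.2 = (v (i + 1)).2 - (v i).2 := by simp [hd]
  have hsub1 : ∀ x : ℝ × ℝ, (x - z).1 = x.1 - z.1 := fun _ => rfl
  have hsub2 : ∀ x : ℝ × ℝ, (x - z).2 = x.2 - z.2 := fun _ => rfl
  clear_value u d p
  have hc₀ : u.1 * (v i - z).2 - u.2 * (v i - z).1 = -s * (u.1 * d.2 - u.2 * d.1) := by
    rw [hsub1, hsub2, hz1, hz2, hps1, hps2, hd1, hd2]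
    ring
  have hc₁ : u.1 * (v (i + 1) - z).2 - u.2 * (v (i + 1) - z).1 =
      (1 - s) * (u.1 * d.2 - u.2 * d.1) := by
    rw [hsub1, hsub2, hz1, hz2, hps1, hps2, hd1, hd2]
    ring
  rw [hc₀] at hcross₀
  rw [hc₁] at hcross₁
  have hdet : u.1 * d.2 - u.2 * d.1 ≠ 0 := right_ne_zero_of_mul hcross₀
  have hs0' : 0 < s := hs0.lt_of_ne' (neg_ne_zero.1 (left_ne_zero_of_mul hcross₀))
  have hs1' : 0 < 1 - s := (sub_nonneg.2 hs1).lt_of_ne' (left_ne_zero_of_mul hcross₁)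
  obtain ⟨e, he⟩ := exists_affine_coordinates p u d hdet
  have hei : e (0, -s) = v i := by
    rw [he]
    refine Prod.ext ?_ ?_ <;> simp [hps1, hps2, hd]
  have hei' : e (0, 1 - s) = v (i + 1) := by
    rw [he]
    refine Prod.ext ?_ ?_ <;> simp [hps1, hps2, hd] <;> ring
  have hez : ∀ t, e (t, 0) = z + (t₀ + t) • u := by
    intro t
    rw [he, hpdef, add_smul]
    simp [add_assoc]
  have hreg := hC'.map e.symm
  have hclos : closure (e.symm '' C) = e.symm '' closure C :=
    (e.symm.toHomeomorph.image_closure C).symm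
  obtain ⟨C₂, ⟨m, w, hw⟩, hC₂U, hsub, hzC₂⟩ := hreg.exists_extend_of_coord
    (U := e.symm '' U) (e.symm.toHomeomorph.isOpenMap U hU)
    (by rw [hclos]; exact image_mono hCU) hs0' hs1' (t₀ := t₀)
    (by rw [Function.comp_apply, hvi, ← hei, e.symm_apply_apply])
    (by rw [Function.comp_apply, hvi', ← hei', e.symm_apply_apply]) hpos
    (by
      intro t h1 h2 h3
      rw [hclos, e.image_symm, mem_preimage, hez] at h3
      have := hleast ⟨⟨by linarith, by linarith [ht₀.2]⟩, h3⟩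
      linarith)
    (by
      intro t h1 h2
      rw [e.image_symm, mem_preimage, hez]
      exact hbU _ ⟨by linarith, by linarith [ht₀.2]⟩)
  refine ⟨e '' C₂, ⟨m, _, hw.map e⟩, ?_, ?_, (-t₀, 0), hzC₂, by rw [hez]; simp⟩
  · have h1 : closure (e '' C₂) = e '' closure C₂ := (e.toHomeomorph.image_closure C₂).symm
    rw [h1]
    refine (image_mono hC₂U).trans ?_
    rw [e.image_symm_image]
  · have h1 := image_mono (f := e) hsub
    rwa [e.image_symm_image] at h1

end Extend

section Polygon

open Set Topology

theorem exists_small_region {U : Set (ℝ × ℝ)} (hU : IsOpen U) {x : ℝ × ℝ} (hx : x ∈ U) :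
    ∃ C, (∃ n v, IsChainRegion n v C) ∧ closure C ⊆ U ∧ x ∈ C := by
  obtain ⟨ε, hε, hb⟩ := Metric.isOpen_iff.1 hU x hx
  have h4 : 0 < ε / 4 := by linarith
  obtain ⟨n, v, hv⟩ := isChainRegion_spike h4 h4 one_pos
  let e := ContinuousAffineEquiv.constVAdd ℝ (ℝ × ℝ) x
  have he : ∀ y, e y = x + y := fun _ => rfl
  refine ⟨_, ⟨n, _, hv.map e⟩, ?_, 0, ⟨h4, by simpa using hε⟩, by rw [he, add_zero]⟩
  have h1 : closure (e '' spike (ε / 4) (ε / 4) 1) = e '' closure (spike (ε / 4) (ε / 4) 1) :=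
    (e.toHomeomorph.image_closure _).symm
  rw [h1, closure_spike h4 h4 one_pos]
  rintro _ ⟨y, ⟨hy1, hy2⟩, rfl⟩
  refine hb ?_
  have h3 := abs_nonneg y.2
  rw [he, mem_ball_iff_norm', sub_add_cancel_left, norm_neg, Prod.norm_def, Real.norm_eq_abs,
    Real.norm_eq_abs]
  refine max_lt (abs_lt.2 ⟨?_, ?_⟩) ?_ <;> linarith

theorem exists_translate {C U F : Set (ℝ × ℝ)} (hC : ∃ n v, IsChainRegion n v C) (hU : IsOpen U)
    (hCU : closure C ⊆ U) (hF : F.Finite) (hFC : F ⊆ C) {z : ℝ × ℝ} (hz : z ∈ closure C) :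
    ∃ C', (∃ n v, IsChainRegion n v C') ∧ closure C' ⊆ U ∧ insert z F ⊆ C' := by
  obtain ⟨n, v, hC⟩ := hC
  have hW : IsOpen ((fun q : (ℝ × ℝ) × (ℝ × ℝ) => q.1 + q.2) ⁻¹' U) := hU.preimage (by fun_prop)
  obtain ⟨V, V', hV, -, h0V, hCV', hVW⟩ := generalized_tube_lemma (s := {(0 : ℝ × ℝ)})
    isCompact_singleton hC.isBounded.isCompact_closure hW (by
      rintro ⟨a, b⟩ ⟨ha, hb⟩
      obtain rfl : a = 0 := ha
      simpa using hCU hb)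
  have hsub : Filter.Tendsto (fun c : ℝ × ℝ => z - c) (𝓝 z) (𝓝 0) := by
    have : Continuous fun c : ℝ × ℝ => z - c := by fun_prop
    simpa using this.tendsto z
  have hev1 : ∀ᶠ c in 𝓝 z, z - c ∈ V := hsub (hV.mem_nhds (h0V rfl))
  have hev2 : ∀ᶠ c in 𝓝 z, ∀ f ∈ F, f - (z - c) ∈ C := by
    refine (Filter.eventually_all_finite hF).2 fun f hf => ?_
    have h1 : Filter.Tendsto (fun c : ℝ × ℝ => f - (z - c)) (𝓝 z) (𝓝 f) := by
      simpa using hsub.const_sub f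
    exact h1 (hC.isOpen.mem_nhds (hFC hf))
  obtain ⟨c, hcC, hcV, hcF⟩ :=
    ((mem_closure_iff_frequently.1 hz).and_eventually (hev1.and hev2)).exists
  let e := ContinuousAffineEquiv.constVAdd ℝ (ℝ × ℝ) (z - c)
  have he : ∀ y, e y = z - c + y := fun _ => rfl
  refine ⟨_, ⟨n, _, hC.map e⟩, ?_, insert_subset ⟨c, hcC, by rw [he, sub_add_cancel]⟩
    fun f hf => ⟨_, hcF f hf, by rw [he, add_sub_cancel]⟩⟩
  have h1 : closure (e '' C) = e '' closure C := (e.toHomeomorph.image_closure _).symm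
  rw [h1]
  rintro _ ⟨y, hy, rfl⟩
  exact hVW (show (z - c, y) ∈ V ×ˢ V' from ⟨hcV, hCV' hy⟩)

theorem exists_chainRegion {U : Set (ℝ × ℝ)} (hU : IsOpen U) (hc : IsConnected U)
    {F : Set (ℝ × ℝ)} (hF : F.Finite) (hFU : F ⊆ U) :
    ∃ C, (∃ n v, IsChainRegion n v C) ∧ closure C ⊆ U ∧ F ⊆ C := by
  induction F, hF using Set.Finite.induction_on with
  | empty =>
    obtain ⟨x, hx⟩ := hc.nonempty
    obtain ⟨C, h1, h2, -⟩ := exists_small_region hU hx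
    exact ⟨C, h1, h2, empty_subset _⟩
  | @insert z₀ F _ hF ih =>
    rw [insert_subset_iff] at hFU
    obtain ⟨C, hC, hCU, hFC⟩ := ih hFU.2
    set Z : Set (ℝ × ℝ) :=
      {z | ∃ C, (∃ n v, IsChainRegion n v C) ∧ closure C ⊆ U ∧ insert z F ⊆ C} with hZ
    have hZo : IsOpen Z := by
      refine isOpen_iff_mem_nhds.2 ?_
      rintro z ⟨C, ⟨n, v, hC⟩, hCU, hzC⟩
      rw [insert_subset_iff] at hzC
      filter_upwards [hC.isOpen.mem_nhds hzC.1] with y hy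
      exact ⟨C, ⟨n, v, hC⟩, hCU, insert_subset hy hzC.2⟩
    refine hc.isPreconnected.subset_of_closure_inter_subset hZo ?_ ?_ hFU.1
    · obtain ⟨n, v, hC'⟩ := hC
      obtain ⟨y, hy⟩ := hC'.isConnected.nonempty
      exact ⟨y, hCU (subset_closure hy), C, ⟨n, v, hC'⟩, hCU, insert_subset hy hFC⟩
    · rintro z ⟨hz, hzU⟩
      obtain ⟨ε, hε, hb⟩ := Metric.isOpen_iff.1 hU z hzU
      obtain ⟨a, ⟨C', hC', hC'U, haC'⟩, hza⟩ := Metric.mem_closure_iff.1 hz ε hε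
      rw [insert_subset_iff] at haC'
      by_cases hzC : z ∈ closure C'
      · exact exists_translate hC' hU hC'U hF haC'.2 hzC
      · have hseg : segment ℝ z a ⊆ U := by
          refine ((convex_ball z ε).segment_subset (Metric.mem_ball_self hε) ?_).trans hb
          rwa [Metric.mem_ball']
        obtain ⟨C'', h1, h2, h3, h4⟩ := exists_extend hC' hU hC'U hzC haC'.1 hseg
        exact ⟨C'', h1, h2, insert_subset h4 (haC'.2.trans h3)⟩

/-- Finitely many points of a connected open subset of the plane lie in an open simple polygon
contained in it. -/
theorem exists_isOpenPolygon {U : Set Plane} (hU : IsOpen U) (hc : IsConnected U)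
    {F : Set Plane} (hF : F.Finite) (hFU : F ⊆ U) :
    ∃ C, IsOpenPolygon C ∧ F ⊆ C ∧ C ⊆ U := by
  have hdim : Module.finrank ℝ Plane = Module.finrank ℝ (ℝ × ℝ) := by simp
  let e : Plane ≃ᴬ[ℝ] (ℝ × ℝ) := (ContinuousLinearEquiv.ofFinrankEq hdim).toContinuousAffineEquiv
  obtain ⟨C, ⟨n, v, hC⟩, hCU, hFC⟩ := exists_chainRegion (e.toHomeomorph.isOpenMap U hU)
    (hc.image e e.continuous.continuousOn) (hF.image e) (image_mono hFU)
  refine ⟨e.symm '' C, (hC.map e.symm).isOpenPolygon, ?_, ?_⟩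
  · have := image_mono (f := e.symm) hFC
    rwa [e.symm_image_image] at this
  · have := image_mono (f := e.symm) (subset_closure.trans hCU)
    exact this.trans (e.symm_image_image U).subset

end Polygon

section Representation

open Set Topology

theorem isConnected_compl_closedBall_zero {E : Type*} [NormedAddCommGroup E] [NormedSpace ℝ E]
    (h : 1 < Module.rank ℝ E) {R : ℝ} (hR : 0 ≤ R) :
    IsConnected (Metric.closedBall (0 : E) R)ᶜ := by
  have h1 : IsConnected ((fun q : ℝ × E => q.1 • q.2) '' (Ioi R ×ˢ Metric.sphere (0 : E) 1)) :=
    (isConnected_Ioi.prod (isConnected_sphere h 0 zero_le_one)).image _ (by fun_prop)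
  convert h1 using 1
  ext x
  constructor
  · intro hx
    have hx' : R < ‖x‖ := by simpa using hx
    have hx0 : 0 < ‖x‖ := hR.trans_lt hx'
    refine ⟨(‖x‖, ‖x‖⁻¹ • x), ⟨hx', ?_⟩, ?_⟩
    · simp [norm_smul, hx0.ne']
    · simp [smul_smul, hx0.ne']
  · rintro ⟨⟨r, y⟩, ⟨hr, hy⟩, rfl⟩
    have hr' : R < r := hr
    have hy' : ‖y‖ = 1 := by simpa using hy
    simpa [norm_smul, hy'] using hr'.trans_le (le_abs_self r)

theorem unboundedComponent_anti {D D' : Set Plane} (h : D ⊆ D') :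
    unboundedComponent D' ⊆ unboundedComponent D := fun _ hx =>
  ⟨fun hD => hx.1 (h hD), fun hb =>
    hx.2 (hb.subset (connectedComponentIn_mono _ (compl_subset_compl.2 h)))⟩

/-- Finitely many points from which a ray escapes to infinity in the complement of a compact set
lie in an open simple polygon in the unbounded component of that complement. -/
theorem exists_isOpenPolygon_of_rays {D F : Set Plane} (hD : IsCompact D) (hF : F.Finite)
    (hray : ∀ z ∈ F, ∃ v ≠ (0 : Plane), ∀ t : ℝ, 0 ≤ t → z + t • v ∉ D) :
    ∃ C, IsOpenPolygon C ∧ F ⊆ C ∧ C ⊆ unboundedComponent D := by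
  obtain ⟨R, hR⟩ := hD.isBounded.subset_closedBall 0
  set R' := max R 0 with hR'
  set O : Set Plane := (Metric.closedBall (0 : Plane) R')ᶜ with hO
  have hrank : 1 < Module.rank ℝ Plane := by
    rw [← Module.finrank_eq_rank]
    simp
  have hOc : IsConnected O := isConnected_compl_closedBall_zero hrank (le_max_right _ _)
  have hOD : O ⊆ Dᶜ := compl_subset_compl.2
    (hR.trans (Metric.closedBall_subset_closedBall (le_max_left _ _)))
  have hOunb : ¬ Bornology.IsBounded O := by
    intro hb
    obtain ⟨S, hS⟩ := hb.subset_closedBall 0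
    obtain ⟨x, hx⟩ := exists_norm_eq Plane
      (show (0 : ℝ) ≤ max S R' + 1 by have := le_max_right S R'; have := le_max_right R 0; linarith)
    have h1 : x ∈ O := by
      simp only [hO, mem_compl_iff, mem_closedBall_zero_iff, not_le, hx]
      linarith [le_max_right S R']
    have h2 := hS h1
    rw [mem_closedBall_zero_iff, hx] at h2
    linarith [le_max_left S R']
  obtain ⟨x₀, hx₀⟩ := hOc.nonempty
  set U := connectedComponentIn Dᶜ x₀ with hU
  have hOU : O ⊆ U := hOc.isPreconnected.subset_connectedComponentIn hx₀ hOD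
  have hUo : IsOpen U := hD.isClosed.isOpen_compl.connectedComponentIn
  have hUc : IsConnected U := isConnected_connectedComponentIn_iff.2 (hOD hx₀)
  have hUunb : U ⊆ unboundedComponent D := by
    intro y hy
    refine ⟨connectedComponentIn_subset _ _ hy, ?_⟩
    rw [← connectedComponentIn_eq hy]
    exact fun hb => hOunb (hb.subset hOU)
  have hFU : F ⊆ U := by
    intro z hz
    obtain ⟨v, hv, hzD⟩ := hray z hz
    have hpre : IsPreconnected ((fun t : ℝ => z + t • v) '' Ici 0) :=
      isPreconnected_Ici.image _ (by fun_prop)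
    have hv' : 0 < ‖v‖ := norm_pos_iff.2 hv
    set T := (R' + 1 + ‖z‖) / ‖v‖ with hT
    have hR0 : 0 ≤ R' := le_max_right _ _
    have hT0 : 0 ≤ T := by positivity
    have hfar : z + T • v ∈ O := by
      simp only [hO, mem_compl_iff, mem_closedBall_zero_iff, not_le]
      have h1 : ‖T • v‖ = R' + 1 + ‖z‖ := by
        rw [norm_smul, Real.norm_of_nonneg hT0, hT, div_mul_cancel₀ _ hv'.ne']
      have h2 : ‖T • v‖ ≤ ‖z + T • v‖ + ‖z‖ := by
        simpa using norm_sub_le (z + T • v) z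
      linarith
    have h3 := hpre.subset_connectedComponentIn (x := z + T • v) (F := Dᶜ) ⟨T, hT0, rfl⟩
      (by rintro _ ⟨t, ht, rfl⟩; exact hzD t ht)
    rw [← connectedComponentIn_eq (hOU hfar)] at h3
    exact h3 ⟨0, self_mem_Ici, by simp⟩
  obtain ⟨C, h1, h2, h3⟩ := exists_isOpenPolygon hUo hUc hF hFU
  exact ⟨C, h1, h2, h3.trans hUunb⟩

/-- The property of having an outside-obstacle representation passes to induced subgraphs. -/
theorem HasOutsideObstacleRepresentation.of_embedding {V W : Type*} [Finite V]
    {G : SimpleGraph V} {H : SimpleGraph W} (h : HasOutsideObstacleRepresentation H)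
    (f : G ↪g H) : HasOutsideObstacleRepresentation G := by
  obtain ⟨C, P, hCP⟩ := h
  obtain ⟨φ⟩ := hCP.nonempty_iso
  set g : V → Plane := fun v => (φ (f v) : Plane) with hg
  have hgi : Function.Injective g := fun a b hab =>
    f.injective (φ.injective (Subtype.ext hab))
  have hgP : range g ⊆ P := by
    rintro _ ⟨v, rfl⟩
    exact (φ (f v)).2
  have hdraw : visibilityDrawing C (range g) ⊆ visibilityDrawing C P := by
    refine union_subset_union hgP ?_
    simp only [iUnion_subset_iff]
    intro p q hpq x hx
    simp only [mem_iUnion]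
    exact ⟨⟨p, hgP p.2⟩, ⟨q, hgP q.2⟩, ⟨fun h => hpq.1 (Subtype.ext (Subtype.mk.inj h)),
      hpq.2⟩, hx⟩
  refine ⟨C, range g, hCP.isOpenPolygon, finite_range g,
    fun p hp q hq r hr => hCP.inGeneralPosition p (hgP hp) q (hgP hq) r (hgP hr),
    hgP.trans hCP.subset_compl, ⟨⟨Equiv.ofInjective g hgi, ?_⟩⟩,
    hCP.outside.trans (unboundedComponent_anti hdraw)⟩
  intro a b
  rw [← f.map_adj_iff, ← φ.map_adj_iff]
  simp only [visibilityGraph, ne_eq, Subtype.ext_iff, Equiv.ofInjective_apply, hg]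

/-- A straight-line drawing in which a ray escapes from a point of each non-edge to infinity
without meeting the drawing gives an outside-obstacle representation. -/
theorem HasOutsideObstacleRepresentation.of_rays {V : Type*} [Finite V] {G : SimpleGraph V}
    (P : V → Plane) (hP : Function.Injective P) (hgen : InGeneralPosition (range P))
    (hray : ∀ i j, i ≠ j → ¬ G.Adj i j → ∃ z ∈ segment ℝ (P i) (P j), ∃ v ≠ (0 : Plane),
      ∀ t : ℝ, 0 ≤ t → (∀ k, z + t • v ≠ P k) ∧
        ∀ k l, G.Adj k l → z + t • v ∉ segment ℝ (P k) (P l)) :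
    HasOutsideObstacleRepresentation G := by
  set D : Set Plane := range P ∪ ⋃ (k : V) (l : V) (_ : G.Adj k l), segment ℝ (P k) (P l) with hD
  have hDc : IsCompact D := by
    refine (finite_range P).isCompact.union ?_
    refine isCompact_iUnion fun k => isCompact_iUnion fun l => isCompact_iUnion fun _ => ?_
    rw [segment_eq_image_lineMap]
    exact isCompact_Icc.image AffineMap.lineMap_continuous
  have hray' : ∀ i j, ∃ z, i ≠ j → ¬ G.Adj i j → z ∈ segment ℝ (P i) (P j) ∧ ∃ v ≠ (0 : Plane),
      ∀ t : ℝ, 0 ≤ t → z + t • v ∉ D := by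
    intro i j
    by_cases h : i ≠ j ∧ ¬ G.Adj i j
    · obtain ⟨z, hz, v, hv, ht⟩ := hray i j h.1 h.2
      refine ⟨z, fun _ _ => ⟨hz, v, hv, fun t ht0 hmem => ?_⟩⟩
      rcases hmem with ⟨k, hk⟩ | hmem
      · exact (ht t ht0).1 k hk.symm
      · simp only [mem_iUnion] at hmem
        obtain ⟨k, l, hkl, hm⟩ := hmem
        exact (ht t ht0).2 k l hkl hm
    · exact ⟨0, fun h1 h2 => (h ⟨h1, h2⟩).elim⟩
  choose z hz using hray'
  obtain ⟨C, hC, hFC, hCU⟩ := exists_isOpenPolygon_of_rays hDc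
    (F := (fun q : V × V => z q.1 q.2) '' {q | q.1 ≠ q.2 ∧ ¬ G.Adj q.1 q.2})
    ((toFinite _).image _) (by
      rintro _ ⟨q, ⟨h1, h2⟩, rfl⟩
      exact (hz q.1 q.2 h1 h2).2)
  have hCD : Disjoint D C := Set.disjoint_left.2 fun x hx hxC => (hCU hxC).1 hx
  have hadj : ∀ i j, i ≠ j → (Disjoint (segment ℝ (P i) (P j)) C ↔ G.Adj i j) := by
    intro i j hij
    constructor
    · intro h
      by_contra hG
      exact h.notMem_of_mem_left (hz i j hij hG).1 (hFC ⟨(i, j), ⟨hij, hG⟩, rfl⟩)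
    · intro h
      refine hCD.mono_left (subset_union_of_subset_right ?_ _)
      intro x hx
      simp only [mem_iUnion]
      exact ⟨i, j, h, hx⟩
  have hdraw : visibilityDrawing C (range P) ⊆ D := by
    refine union_subset_union_right _ ?_
    simp only [iUnion_subset_iff]
    rintro ⟨_, i, rfl⟩ ⟨_, j, rfl⟩ ⟨hij, hd⟩ x hx
    have hij' : i ≠ j := fun h => hij (Subtype.ext (congrArg P h))
    simp only [mem_iUnion]
    exact ⟨i, j, (hadj i j hij').1 hd, hx⟩
  refine ⟨C, range P, hC, finite_range P, hgen, ?_, ⟨⟨Equiv.ofInjective P hP, ?_⟩⟩,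
    hCU.trans (unboundedComponent_anti hdraw)⟩
  · exact fun x hx hxC => hCD.notMem_of_mem_left (Or.inl hx) hxC
  · intro a b
    simp only [visibilityGraph, ne_eq, Subtype.ext_iff, Equiv.ofInjective_apply, hP.eq_iff]
    constructor
    · exact fun h => (hadj a b h.1).1 h.2
    · exact fun h => ⟨h.ne, (hadj a b h.ne).2 h⟩

end Representation

section Geometry

open Set

theorem plane_apply_zero (a b : ℝ) : (!₂[a, b] : Plane) 0 = a := rfl

theorem plane_apply_one (a b : ℝ) : (!₂[a, b] : Plane) 1 = b := rfl

/-- The cross product of two vectors of the plane. -/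
def cross (u v : Plane) : ℝ := u 0 * v 1 - u 1 * v 0

theorem not_collinear_of_cross_ne_zero {p q r : Plane} (h : cross (q - p) (r - p) ≠ 0) :
    ¬ Collinear ℝ {p, q, r} := by
  intro hc
  obtain ⟨v, hv⟩ := (collinear_iff_of_mem (p₀ := p) (by simp)).1 hc
  obtain ⟨a, ha⟩ := hv q (by simp)
  obtain ⟨b, hb⟩ := hv r (by simp)
  apply h
  simp only [cross, ha, hb, vadd_eq_add, add_sub_cancel_right, PiLp.smul_apply, smul_eq_mul]
  ring

theorem ray_ne_of_cross_ne_zero {z v p : Plane} (h : cross v (p - z) ≠ 0) (t : ℝ) :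
    z + t • v ≠ p := by
  rintro rfl
  apply h
  simp only [cross, add_sub_cancel_left, PiLp.smul_apply, smul_eq_mul]
  ring

/-- A numerical criterion for the ray from `z` in direction `v` to miss the segment `cd`. -/
theorem ray_notMem_segment {z v c d : Plane}
    (h : (0 < cross v (c - z) ∧ 0 < cross v (d - z)) ∨
      (cross v (c - z) < 0 ∧ cross v (d - z) < 0) ∨
      (0 < cross (d - c) (c - z) ∧ cross (d - c) v ≤ 0) ∨
      (cross (d - c) (c - z) < 0 ∧ 0 ≤ cross (d - c) v)) {t : ℝ} (ht : 0 ≤ t) :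
    z + t • v ∉ segment ℝ c d := by
  rintro ⟨a, b, ha, hb, hab, hx⟩
  have hx0 := congrArg (fun y : Plane => y 0) hx
  have hx1 := congrArg (fun y : Plane => y 1) hx
  simp only [PiLp.add_apply, PiLp.smul_apply, smul_eq_mul] at hx0 hx1
  obtain rfl : a = 1 - b := by linarith
  have h1 : (1 - b) * cross v (c - z) + b * cross v (d - z) = 0 := by
    simp only [cross, PiLp.sub_apply]
    linear_combination v 0 * hx1 - v 1 * hx0
  have h2 : cross (d - c) (c - z) = t * cross (d - c) v := by
    simp only [cross, PiLp.sub_apply]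
    linear_combination (d 0 - c 0) * hx1 - (d 1 - c 1) * hx0
  rcases h with ⟨h3, h4⟩ | ⟨h3, h4⟩ | ⟨h3, h4⟩ | ⟨h3, h4⟩
  · rcases hb.lt_or_eq with h5 | h5
    · linarith [mul_pos h5 h4, mul_nonneg ha h3.le]
    · subst h5; linarith
  · rcases hb.lt_or_eq with h5 | h5
    · linarith [mul_neg_of_pos_of_neg h5 h4, mul_nonpos_of_nonneg_of_nonpos ha h3.le]
    · subst h5; linarith
  · linarith [mul_nonpos_of_nonneg_of_nonpos ht h4]
  · linarith [mul_nonneg ht h4]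

/-- The cross product of two integer vectors. -/
def intCross (u v : ℤ × ℤ) : ℤ := u.1 * v.2 - u.2 * v.1

/-- An integer vector as a point of the plane. -/
noncomputable def intPoint (u : ℤ × ℤ) : Plane := !₂[(u.1 : ℝ), (u.2 : ℝ)]

theorem cross_intPoint (u v : ℤ × ℤ) : cross (intPoint u) (intPoint v) = (intCross u v : ℤ) := by
  simp [cross, intPoint, intCross]

theorem intPoint_sub (u v : ℤ × ℤ) : intPoint u - intPoint v = intPoint (u - v) := by
  ext i
  fin_cases i <;> simp [intPoint]

theorem cross_smul_right (r : ℝ) (u v : Plane) : cross u (r • v) = r * cross u v := by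
  simp only [cross, PiLp.smul_apply, smul_eq_mul]
  ring

end Geometry

section Drawing

/-- A ray that starts in the point of a segment `pq` with weights `wp`, `wq` and goes in direction
`(dx, dy)`, together with a list of pairs of points whose segments it may cross. -/
structure EscapeRay where
  /-- the weight of the first endpoint -/
  wp : ℕ
  /-- the weight of the second endpoint -/
  wq : ℕ
  /-- the first coordinate of the direction -/
  dx : ℤ
  /-- the second coordinate of the direction -/
  dy : ℤ
  /-- the pairs of points whose segments may be crossed -/
  crossed : List (Fin 7 × Fin 7)

/-- The seven points of the universal drawing. -/
def sevenPoints : Fin 7 → ℤ × ℤ :=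
  ![(2, 0), (6, 0), (6, 5), (1, 6), (0, 5), (0, 1), (5, 2)]

/-- The direction of an escape ray. -/
def EscapeRay.dir (r : EscapeRay) : ℤ × ℤ := (r.dx, r.dy)

/-- The vector from the origin of an escape ray on the segment `ij` to the point `k`, scaled by the
sum of the weights. -/
def EscapeRay.toPoint (r : EscapeRay) (i j k : Fin 7) : ℤ × ℤ :=
  ((r.wp + r.wq : ℕ) : ℤ) • sevenPoints k -
    ((r.wp : ℤ) • sevenPoints i + (r.wq : ℤ) • sevenPoints j)

/-- The ray misses all points, and all segments other than `ij` and those of the pairs listed. -/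
def EscapeRay.IsValid (r : EscapeRay) (i j : Fin 7) : Prop :=
  0 < r.wp ∧ (∀ k, intCross r.dir (r.toPoint i j k) ≠ 0) ∧
    ∀ k l, k < l → (k, l) ≠ (i, j) → (k, l) ∉ r.crossed →
      (0 < intCross r.dir (r.toPoint i j k) ∧ 0 < intCross r.dir (r.toPoint i j l)) ∨
      (intCross r.dir (r.toPoint i j k) < 0 ∧ intCross r.dir (r.toPoint i j l) < 0) ∨
      (0 < intCross (sevenPoints l - sevenPoints k) (r.toPoint i j k) ∧
        intCross (sevenPoints l - sevenPoints k) r.dir ≤ 0) ∨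
      (intCross (sevenPoints l - sevenPoints k) (r.toPoint i j k) < 0 ∧
        0 ≤ intCross (sevenPoints l - sevenPoints k) r.dir)

instance (r : EscapeRay) (i j : Fin 7) : Decidable (r.IsValid i j) := by
  unfold EscapeRay.IsValid
  infer_instance

/-- For each pair of points some rays that escape from its segment. -/
def escapeRays : List ((Fin 7 × Fin 7) × List EscapeRay) :=
  [
    ((0, 1), [⟨1, 1, -1, -1, []⟩]),
    ((0, 2), [⟨8, 1, 0, -1, [(0, 1), (0, 6)]⟩,
      ⟨1, 2, 1, -1, [(1, 2), (2, 6)]⟩,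
      ⟨8, 1, -1, -1, [(0, 3), (0, 4), (0, 5)]⟩]),
    ((1, 2), [⟨1, 1, 1, -1, []⟩]),
    ((0, 3), [⟨8, 1, -1, -1, [(0, 4), (0, 5)]⟩,
      ⟨1, 6, -1, 0, [(3, 4), (3, 5)]⟩,
      ⟨8, 1, 1, -1, [(0, 1), (0, 2), (0, 6)]⟩,
      ⟨1, 1, -1, -1, [(0, 4), (3, 5), (4, 5)]⟩,
      ⟨1, 6, 0, 1, [(1, 3), (2, 3), (3, 6)]⟩]),
    ((1, 3), [⟨3, 1, 1, -1, [(1, 2), (1, 6)]⟩,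
      ⟨1, 6, 0, 1, [(2, 3), (3, 6)]⟩]),
    ((2, 3), [⟨1, 1, -1, 1, []⟩]),
    ((0, 4), [⟨7, 1, -1, -1, [(0, 5)]⟩,
      ⟨1, 3, -1, -1, [(4, 5)]⟩]),
    ((1, 4), [⟨3, 1, -1, -1, [(0, 1), (1, 5)]⟩,
      ⟨3, 1, 1, 0, [(1, 2), (1, 3), (1, 6)]⟩]),
    ((2, 4), [⟨1, 1, -1, 1, [(2, 3)]⟩,
      ⟨1, 7, -1, 1, [(3, 4)]⟩]),
    ((3, 4), [⟨1, 1, -1, 0, []⟩]),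
    ((0, 5), [⟨1, 1, -1, -1, []⟩]),
    ((1, 5), [⟨1, 1, -1, -1, [(0, 1)]⟩,
      ⟨1, 3, -1, -1, [(0, 5)]⟩]),
    ((2, 5), [⟨2, 1, -1, 1, [(2, 3), (2, 4)]⟩,
      ⟨1, 4, -1, 0, [(3, 5), (4, 5)]⟩,
      ⟨1, 4, -1, -1, [(0, 5), (1, 5), (5, 6)]⟩,
      ⟨6, 5, -1, 1, [(0, 3), (2, 4), (3, 4), (3, 5)]⟩]),
    ((3, 5), [⟨5, 1, -1, 0, [(3, 4)]⟩,
      ⟨1, 1, -1, -1, [(4, 5)]⟩,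
      ⟨1, 1, 0, -1, [(0, 5), (1, 5), (2, 5), (5, 6)]⟩]),
    ((4, 5), [⟨1, 1, -1, -1, []⟩]),
    ((0, 6), [⟨3, 1, -1, -1, [(0, 1)]⟩,
      ⟨1, 7, 1, -1, [(1, 2), (1, 6)]⟩]),
    ((1, 6), [⟨1, 1, 1, -1, [(1, 2)]⟩]),
    ((2, 6), [⟨1, 1, 1, -1, [(1, 2)]⟩]),
    ((3, 6), [⟨4, 1, 0, 1, [(2, 3)]⟩,
      ⟨1, 5, 1, 0, [(1, 2), (2, 6)]⟩]),
    ((4, 6), [⟨7, 1, -1, 1, [(2, 4), (3, 4)]⟩,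
      ⟨1, 5, 1, 0, [(1, 2), (2, 6), (3, 6)]⟩]),
    ((5, 6), [⟨3, 1, -1, -1, [(0, 5), (1, 5)]⟩,
      ⟨1, 3, 0, -1, [(0, 1), (1, 5), (0, 6)]⟩])]

theorem escapeRays_valid : ∀ e ∈ escapeRays, ∀ r ∈ e.2, r.IsValid e.1.1 e.1.2 := by
  decide +kernel

theorem exists_mem_escapeRays : ∀ i j : Fin 7, i < j → ∃ e ∈ escapeRays, e.1 = (i, j) := by
  decide +kernel

theorem sevenPoints_generic : ∀ i j k : Fin 7, i ≠ j → i ≠ k → j ≠ k →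
    intCross (sevenPoints j - sevenPoints i) (sevenPoints k - sevenPoints i) ≠ 0 := by
  decide +kernel

theorem sevenPoints_injective : Function.Injective sevenPoints := by
  decide +kernel

theorem intPoint_injective : Function.Injective intPoint := by
  intro u v h
  have h0 := congrArg (fun y : Plane => y 0) h
  have h1 := congrArg (fun y : Plane => y 1) h
  simp only [intPoint, plane_apply_zero, plane_apply_one, Int.cast_inj] at h0 h1
  exact Prod.ext h0 h1

theorem inGeneralPosition_sevenPoints :
    InGeneralPosition (Set.range fun i => intPoint (sevenPoints i)) := by
  rintro _ ⟨i, rfl⟩ _ ⟨j, rfl⟩ _ ⟨k, rfl⟩ hij hik hjk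
  apply not_collinear_of_cross_ne_zero
  rw [intPoint_sub, intPoint_sub, cross_intPoint, Int.cast_ne_zero]
  exact sevenPoints_generic i j k (fun h => hij (by rw [h])) (fun h => hik (by rw [h]))
    fun h => hjk (by rw [h])

theorem EscapeRay.IsValid.exists_ray {r : EscapeRay} {i j : Fin 7} (h : r.IsValid i j) :
    ∃ z ∈ segment ℝ (intPoint (sevenPoints i)) (intPoint (sevenPoints j)), ∃ v ≠ (0 : Plane),
      ∀ t : ℝ, 0 ≤ t → (∀ k, z + t • v ≠ intPoint (sevenPoints k)) ∧
        ∀ k l, k < l → (k, l) ≠ (i, j) → (k, l) ∉ r.crossed →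
          z + t • v ∉ segment ℝ (intPoint (sevenPoints k)) (intPoint (sevenPoints l)) := by
  obtain ⟨hw, hpt, hseg⟩ := h
  set w : ℝ := ((r.wp + r.wq : ℕ) : ℝ) with hwdef
  have hw0 : 0 < w := by rw [hwdef]; exact_mod_cast (by omega : 0 < r.wp + r.wq)
  set z : Plane := ((r.wp : ℝ) / w) • intPoint (sevenPoints i) +
    ((r.wq : ℝ) / w) • intPoint (sevenPoints j) with hz
  have hto : ∀ k, intPoint (sevenPoints k) - z = w⁻¹ • intPoint (r.toPoint i j k) := by
    intro k
    have hw' : w = r.wp + r.wq := by rw [hwdef]; push_cast; ring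
    have hw1 : (r.wp : ℝ) + r.wq ≠ 0 := hw' ▸ hw0.ne'
    rw [hz, hw']
    ext a
    fin_cases a <;> simp [intPoint, EscapeRay.toPoint] <;> field_simp
  have hcr : ∀ u k, cross (intPoint u) (intPoint (sevenPoints k) - z) =
      w⁻¹ * (intCross u (r.toPoint i j k) : ℤ) := by
    intro u k
    rw [hto, cross_smul_right, cross_intPoint]
  have hpos : ∀ n : ℤ, 0 < w⁻¹ * (n : ℝ) ↔ 0 < n := fun n => by
    rw [mul_pos_iff_of_pos_left (inv_pos.2 hw0), Int.cast_pos]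
  have hneg : ∀ n : ℤ, w⁻¹ * (n : ℝ) < 0 ↔ n < 0 := fun n => by
    simpa using hpos (-n)
  refine ⟨z, ⟨r.wp / w, r.wq / w, by positivity, by positivity, ?_, rfl⟩, intPoint r.dir, ?_,
    fun t ht => ⟨fun k => ray_ne_of_cross_ne_zero ?_ t, fun k l hkl h1 h2 =>
      ray_notMem_segment ?_ ht⟩⟩
  · rw [← add_div, hwdef]
    push_cast
    exact div_self (by exact_mod_cast (by omega : r.wp + r.wq ≠ 0))
  · intro h0
    have := cross_intPoint r.dir (r.toPoint i j 0)
    rw [h0] at this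
    apply hpt 0
    have h1 : cross 0 (intPoint (r.toPoint i j 0)) = 0 := by simp [cross]
    rw [h1] at this
    exact_mod_cast this.symm
  · rw [hcr]
    exact mul_ne_zero (inv_ne_zero hw0.ne') (Int.cast_ne_zero.2 (hpt k))
  · rw [intPoint_sub, hcr, hcr, hcr, cross_intPoint, hpos, hpos, hpos, hneg, hneg, hneg,
      Int.cast_nonpos, Int.cast_nonneg_iff]
    exact hseg k l hkl h1 h2

theorem hasOutsideObstacleRepresentation_of_escapeRays {H : SimpleGraph (Fin 7)}
    (h : ∀ e ∈ escapeRays, H.Adj e.1.1 e.1.2 ∨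
      ∃ r ∈ e.2, ∀ q ∈ r.crossed, ¬ H.Adj q.1 q.2) :
    HasOutsideObstacleRepresentation H := by
  have key : ∀ i j : Fin 7, i < j → ¬ H.Adj i j →
      ∃ z ∈ segment ℝ (intPoint (sevenPoints i)) (intPoint (sevenPoints j)), ∃ v ≠ (0 : Plane),
      ∀ t : ℝ, 0 ≤ t → (∀ k, z + t • v ≠ intPoint (sevenPoints k)) ∧ ∀ k l, H.Adj k l →
        z + t • v ∉ segment ℝ (intPoint (sevenPoints k)) (intPoint (sevenPoints l)) := by
    intro i j hij hadj
    obtain ⟨e, he, hei⟩ := exists_mem_escapeRays i j hij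
    have h1 := h e he
    have h2 := escapeRays_valid e he
    rw [hei] at h1 h2
    obtain ⟨r, hr, hcr⟩ := h1.resolve_left hadj
    obtain ⟨z, hz, v, hv, ht⟩ := (h2 r hr).exists_ray
    have hlt : ∀ t : ℝ, 0 ≤ t → ∀ k l, k < l → H.Adj k l →
        z + t • v ∉ segment ℝ (intPoint (sevenPoints k)) (intPoint (sevenPoints l)) := by
      intro t ht0 k l hkl hA
      refine (ht t ht0).2 k l hkl ?_ fun hmem => hcr _ hmem hA
      rintro heq
      obtain ⟨rfl, rfl⟩ := Prod.mk.inj heq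
      exact hadj hA
    refine ⟨z, hz, v, hv, fun t ht0 => ⟨(ht t ht0).1, fun k l hA => ?_⟩⟩
    rcases lt_or_gt_of_ne hA.ne with h3 | h3
    · exact hlt t ht0 k l h3 hA
    · rw [segment_symm]
      exact hlt t ht0 l k h3 hA.symm
  refine HasOutsideObstacleRepresentation.of_rays (fun i => intPoint (sevenPoints i))
    (intPoint_injective.comp sevenPoints_injective) inGeneralPosition_sevenPoints ?_
  intro i j hij hadj
  rcases lt_or_gt_of_ne hij with h1 | h1
  · exact key i j h1 hadj
  · rw [segment_symm]
    exact key j i h1 fun h2 => hadj h2.symm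

end Drawing

section Search

/-- The pairs of vertices in the order in which the search decides their adjacency. -/
def vertexPairs : List (Fin 7 × Fin 7) :=
  [(0, 1), (0, 2), (1, 2), (0, 3), (1, 3), (2, 3), (0, 4), (1, 4), (2, 4), (3, 4), (0, 5), (1, 5),
    (2, 5), (3, 5), (4, 5), (0, 6), (1, 6), (2, 6), (3, 6), (4, 6), (5, 6)]

/-- The position of a pair in `vertexPairs`. -/
def pairIndex (i j : Fin 7) : ℕ :=
  if i.val < j.val then j.val * (j.val - 1) / 2 + i.val else i.val * (i.val - 1) / 2 + j.val

theorem pairIndex_eq_iff : ∀ i j k l : Fin 7, i ≠ j → k ≠ l → pairIndex i j = pairIndex k l →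
    (i = k ∧ j = l) ∨ (i = l ∧ j = k) := by
  decide +kernel

/-- The adjacency of `i` and `j`, if it is among the known ones. -/
def known (l : List Bool) (i j : Fin 7) : Option Bool := l[pairIndex i j]?

/-- The adjacencies in `l` are those of `G`. -/
def Agrees (l : List Bool) (G : SimpleGraph (Fin 7)) : Prop :=
  ∀ i j b, i ≠ j → known l i j = some b → (b = true ↔ G.Adj i j)

/-- The map of `Fin 7` to itself with the given decimal digits. -/
def digitMap (c : ℕ) (i : Fin 7) : Fin 7 := Fin.ofNat 7 (c / 10 ^ (6 - i.val) % 10)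

/-- All graphs that agree with `l` have a lexicographically smaller list of adjacencies than their
relabellings along `σ`. -/
def improves (l : List Bool) (σ : Fin 7 → Fin 7) : List (Fin 7 × Fin 7) → Bool
  | [] => false
  | p :: ps =>
    match known l p.1 p.2, known l (σ p.1) (σ p.2) with
    | some x, some y => if x = y then improves l σ ps else !x
    | _, _ => false

/-- All graphs that agree with `l` can be drawn with the vertex `σ i` at the `i`-th point. -/
def placeable (l : List Bool) (σ : Fin 7 → Fin 7) : Bool :=
  escapeRays.all fun e => known l (σ e.1.1) (σ e.1.2) == some true ||
    e.2.any fun r => r.crossed.all fun q => known l (σ q.1) (σ q.2) == some false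

/-- The relabellings used in the search. -/
def relabellings : List ℕ :=
  [
    123465, 123546, 214356, 132456, 1024356, 213456, 1023546, 1045236, 1032456, 124356, 213546,
    3450126, 1023465, 1032546, 341256, 1025346, 2013645, 2301546, 2301456, 5426013, 5206341,
    3510624, 6135402, 4163250, 6054312, 6203451, 5360241, 4152063, 6053241, 3452160, 4023561,
    5124360, 5421603, 1526340, 4052361, 4356012, 4523601, 245361, 1356042, 1426053, 1534620,
    2036451, 2605413, 3162450, 3421605, 265413, 341562, 345612, 453126, 532146, 1243560, 2506341,
    2541036, 4063251, 4531260, 5361240, 6142350, 142563, 143562, 153462, 253416, 314526, 321546,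
    614235, 614325, 632415, 1230654, 1253460, 1352460, 1354260, 1432650, 1523460, 1536420,
    1542306, 2034651, 2543016, 2610435, 3415062, 3520614, 4021563, 4321560, 4351260, 5264130,
    5364120]

/-- The relabelling number `n`. -/
def relabelling (n : ℕ) : Fin 7 → Fin 7 := digitMap (relabellings.getD n 123456)

theorem relabelling_injective (n : ℕ) : Function.Injective (relabelling n) := by
  have h : ∀ c ∈ 123456 :: relabellings, Function.Injective (digitMap c) := by decide +kernel
  refine h _ ?_
  rw [List.getD_eq_getElem?_getD]
  rcases hn : relabellings[n]? with _ | c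
  · simp
  · exact List.mem_cons_of_mem _ (List.mem_of_getElem? hn)

/-- Runs through a search tree, given in preorder: `0` branches on the first unknown adjacency, and
`n + 1` is a leaf that is settled by the relabelling number `n`. -/
def runSearch : ℕ → List Bool → List ℕ → Option (List ℕ)
  | 0, _, _ => none
  | _ + 1, _, [] => none
  | d + 1, l, 0 :: cs => (runSearch d (l ++ [true]) cs).bind (runSearch d (l ++ [false]))
  | _ + 1, l, (n + 1) :: cs =>
    if improves l (relabelling n) vertexPairs || placeable l (relabelling n) then some cs else none

/-- The search tree. -/
def searchTree : List ℕ :=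
  [
    0, 0, 0, 0, 0, 0, 0, 0, 0, 0, 0, 0, 0, 0, 0, 0, 0, 0, 0, 31, 32, 0, 4, 35, 0, 3, 0, 4, 30, 0,
    5, 0, 3, 0, 4, 20, 0, 0, 0, 42, 46, 0, 6, 55, 0, 7, 0, 6, 26, 0, 3, 0, 0, 0, 49, 0, 26, 46,
    0, 3, 55, 0, 5, 0, 3, 26, 0, 4, 0, 5, 0, 0, 0, 1, 53, 0, 69, 70, 0, 5, 0, 24, 26, 0, 3, 0, 4,
    0, 3, 0, 0, 1, 0, 1, 56, 0, 0, 13, 27, 0, 3, 22, 0, 5, 0, 3, 0, 4, 0, 3, 0, 1, 0, 1, 0, 1,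
    22, 0, 0, 0, 0, 2, 0, 3, 0, 0, 26, 51, 0, 5, 21, 0, 0, 0, 0, 75, 0, 72, 30, 0, 5, 0, 52, 21,
    0, 0, 76, 0, 0, 48, 42, 30, 0, 14, 0, 52, 21, 0, 5, 0, 0, 61, 68, 0, 5, 21, 0, 3, 0, 0, 0, 0,
    1, 30, 0, 0, 13, 34, 0, 3, 21, 0, 0, 1, 30, 0, 0, 13, 34, 0, 6, 21, 0, 3, 0, 0, 1, 0, 1, 26,
    0, 38, 21, 0, 5, 0, 3, 0, 0, 0, 1, 0, 1, 21, 0, 1, 0, 1, 21, 0, 3, 0, 1, 0, 1, 21, 0, 4, 0,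
    0, 0, 2, 0, 2, 0, 0, 0, 0, 1, 0, 1, 35, 0, 0, 17, 0, 24, 42, 0, 4, 77, 0, 7, 0, 24, 21, 0, 0,
    0, 1, 20, 0, 24, 26, 0, 7, 21, 0, 0, 11, 0, 0, 0, 1, 0, 11, 82, 0, 0, 0, 13, 73, 27, 0, 11,
    20, 0, 0, 1, 51, 0, 38, 60, 0, 4, 0, 0, 0, 1, 0, 1, 41, 0, 0, 13, 27, 0, 57, 21, 0, 0, 1, 0,
    1, 26, 0, 38, 21, 0, 9, 0, 0, 0, 0, 1, 0, 1, 0, 18, 20, 0, 1, 0, 1, 0, 18, 20, 0, 0, 1, 0, 1,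
    44, 0, 1, 0, 1, 44, 0, 4, 0, 0, 1, 0, 1, 21, 0, 1, 0, 1, 21, 0, 6, 0, 4, 0, 0, 2, 0, 2, 0, 2,
    0, 0, 0, 1, 0, 1, 41, 0, 0, 17, 27, 0, 6, 21, 0, 0, 1, 56, 0, 27, 21, 0, 0, 7, 0, 4, 0, 0, 1,
    0, 7, 25, 0, 1, 0, 7, 25, 0, 6, 0, 4, 0, 0, 1, 0, 1, 21, 0, 1, 0, 1, 21, 0, 9, 0, 6, 0, 4, 0,
    2, 0, 2, 0, 2, 0, 2, 0, 0, 1, 0, 1, 80, 0, 1, 0, 1, 21, 0, 0, 0, 3, 0, 4, 0, 0, 0, 2, 0, 2,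
    0, 5, 0, 24, 20, 0, 0, 0, 0, 32, 0, 40, 20, 0, 74, 0, 40, 20, 0, 10, 0, 0, 1, 0, 48, 24, 0,
    40, 20, 0, 4, 0, 10, 0, 24, 20, 0, 5, 0, 0, 0, 0, 1, 20, 0, 1, 20, 0, 5, 0, 1, 20, 0, 4, 0,
    5, 0, 1, 20, 0, 0, 0, 0, 2, 0, 3, 0, 4, 0, 3, 0, 0, 1, 53, 0, 37, 22, 0, 0, 0, 0, 0, 1, 0, 7,
    0, 3, 0, 4, 43, 0, 1, 0, 7, 0, 64, 65, 0, 3, 0, 1, 0, 50, 0, 3, 43, 0, 4, 0, 0, 1, 0, 39, 36,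
    0, 1, 0, 0, 1, 50, 36, 0, 3, 0, 4, 0, 3, 0, 1, 0, 1, 22, 0, 0, 2, 0, 3, 0, 0, 0, 0, 1, 81, 0,
    0, 78, 34, 0, 3, 28, 0, 0, 1, 0, 1, 71, 0, 0, 47, 34, 0, 47, 28, 0, 3, 0, 0, 1, 83, 0, 27,
    22, 0, 0, 0, 7, 0, 3, 0, 1, 0, 7, 59, 0, 0, 0, 1, 0, 14, 28, 0, 1, 0, 14, 28, 0, 0, 1, 0, 39,
    25, 0, 1, 0, 27, 25, 0, 3, 0, 0, 0, 1, 0, 1, 28, 0, 1, 0, 1, 22, 0, 3, 0, 1, 0, 1, 22, 0, 4,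
    0, 0, 2, 0, 2, 0, 2, 0, 0, 0, 1, 0, 1, 41, 0, 39, 20, 0, 24, 20, 0, 0, 7, 0, 4, 0, 0, 1, 0,
    7, 25, 0, 1, 36, 0, 0, 0, 0, 1, 20, 0, 1, 20, 0, 0, 1, 20, 0, 1, 20, 0, 4, 0, 0, 1, 20, 0, 1,
    20, 0, 9, 0, 0, 0, 2, 0, 2, 0, 0, 0, 0, 1, 0, 1, 0, 0, 29, 66, 0, 4, 24, 0, 1, 22, 0, 0, 1,
    0, 1, 0, 57, 43, 0, 1, 22, 0, 4, 0, 0, 1, 31, 0, 1, 22, 0, 2, 0, 2, 0, 0, 2, 0, 0, 1, 0, 1,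
    0, 29, 24, 0, 1, 22, 0, 0, 0, 1, 0, 1, 28, 0, 1, 22, 0, 0, 1, 54, 0, 1, 22, 0, 4, 0, 2, 0, 2,
    0, 2, 0, 2, 0, 0, 1, 31, 0, 1, 20, 0, 6, 0, 0, 5, 0, 3, 0, 0, 0, 2, 0, 2, 0, 15, 0, 3, 0, 0,
    1, 84, 0, 37, 22, 0, 0, 16, 0, 0, 12, 0, 1, 0, 37, 58, 0, 10, 0, 1, 0, 37, 36, 0, 3, 0, 15,
    0, 3, 0, 1, 0, 1, 22, 0, 0, 2, 0, 2, 0, 2, 0, 3, 0, 44, 20, 0, 0, 16, 0, 0, 0, 1, 25, 0, 1,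
    25, 0, 10, 0, 1, 25, 0, 3, 0, 0, 0, 1, 20, 0, 1, 20, 0, 3, 0, 1, 20, 0, 0, 5, 0, 0, 2, 0, 5,
    0, 0, 0, 0, 1, 0, 1, 0, 11, 0, 12, 32, 0, 1, 0, 1, 54, 0, 5, 0, 1, 49, 0, 0, 0, 1, 0, 1, 0,
    1, 0, 12, 32, 0, 1, 79, 0, 5, 0, 1, 25, 0, 2, 0, 5, 0, 0, 11, 0, 5, 0, 1, 29, 0, 0, 0, 1, 29,
    0, 1, 29, 0, 5, 0, 1, 25, 0, 6, 0, 0, 2, 0, 2, 0, 2, 0, 0, 0, 1, 0, 1, 0, 1, 0, 12, 32, 0, 1,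
    22, 0, 0, 1, 31, 0, 1, 22, 0, 2, 0, 2, 0, 2, 0, 2, 0, 0, 1, 31, 0, 1, 20, 0, 7, 0, 6, 0, 3,
    0, 5, 0, 3, 0, 0, 2, 0, 2, 0, 2, 0, 0, 0, 1, 0, 1, 0, 1, 0, 12, 21, 0, 1, 62, 0, 3, 0, 1, 35,
    0, 2, 0, 2, 0, 2, 0, 2, 0, 3, 0, 1, 22, 0, 0, 4, 0, 6, 0, 0, 8, 0, 3, 0, 4, 0, 0, 2, 0, 2, 0,
    2, 0, 3, 20, 33, 0, 0, 0, 0, 2, 0, 0, 0, 0, 8, 23, 0, 8, 23, 0, 4, 0, 8, 23, 0, 6, 0, 4, 23,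
    0, 2, 0, 0, 0, 2, 0, 8, 8, 0, 0, 8, 23, 0, 8, 23, 0, 6, 0, 0, 0, 1, 67, 23, 23, 0, 4, 0, 2,
    0, 0, 2, 0, 2, 0, 8, 23, 0, 0, 11, 0, 0, 1, 29, 23, 0, 4, 23, 0, 6, 0, 4, 0, 2, 33, 0, 0, 0,
    3, 0, 9, 0, 6, 0, 9, 0, 2, 0, 2, 0, 2, 45, 0, 3, 0, 9, 0, 0, 0, 2, 0, 2, 0, 3, 0, 9, 0, 3, 0,
    1, 35, 0, 2, 0, 2, 0, 3, 63, 0, 9, 0, 2, 0, 2, 0, 2, 45, 0, 6, 0, 3, 0, 10, 0, 3, 0, 0, 2, 0,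
    2, 0, 2, 0, 0, 12, 23, 23, 0, 2, 33, 0, 5, 0, 4, 0, 4, 0, 0, 10, 0, 5, 0, 19, 0, 4, 0, 2, 0,
    2, 0, 2, 45, 0, 10, 0, 5, 0, 5, 0, 4, 0, 2, 33, 0, 3, 0, 5, 0, 4, 0, 4, 0, 6, 0, 3, 0, 5, 0,
    3, 0, 4, 0, 2, 33]

theorem runSearch_searchTree : runSearch 22 [] searchTree = some [] := by
  decide +kernel

open Classical in
/-- The adjacencies of the pairs in a list. -/
noncomputable def adjList (G : SimpleGraph (Fin 7)) (ps : List (Fin 7 × Fin 7)) : List Bool :=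
  ps.map fun p => decide (G.Adj p.1 p.2)

theorem adjList_lt_of_improves {G : SimpleGraph (Fin 7)} {l : List Bool} (hl : Agrees l G)
    {σ : Fin 7 → Fin 7} (hσ : Function.Injective σ) (ps : List (Fin 7 × Fin 7))
    (hps : ∀ p ∈ ps, p.1 ≠ p.2) (h : improves l σ ps = true) :
    adjList G ps < adjList (G.comap σ) ps := by
  classical
  induction ps with
  | nil => simp [improves] at h
  | cons p ps ih =>
    have hp := hps p List.mem_cons_self
    rw [improves] at h
    split at h
    · rename_i x y hx hy
      have h1 := hl _ _ _ hp hx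
      have h2 := hl _ _ _ (hσ.ne hp) hy
      have h3 : decide (G.Adj p.1 p.2) = x := by rw [Bool.eq_iff_iff, decide_eq_true_iff, h1]
      have h4 : decide (G.Adj (σ p.1) (σ p.2)) = y := by
        rw [Bool.eq_iff_iff, decide_eq_true_iff, h2]
      simp only [adjList, List.map_cons, SimpleGraph.comap_adj, List.cons_lt_cons_iff, h3, h4]
      split at h
      · rename_i hxy
        exact Or.inr ⟨hxy, ih (fun q hq => hps q (List.mem_cons_of_mem _ hq)) h⟩
      · rename_i hxy
        left
        revert h hxy
        cases x <;> cases y <;> simp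
    · exact absurd h (by simp)

theorem hasOutsideObstacleRepresentation_of_placeable {G : SimpleGraph (Fin 7)} {l : List Bool}
    (hl : Agrees l G) {σ : Fin 7 → Fin 7} (hσ : Function.Injective σ)
    (h : placeable l σ = true) : HasOutsideObstacleRepresentation G := by
  have hne : ∀ e ∈ escapeRays, e.1.1 ≠ e.1.2 ∧ ∀ r ∈ e.2, ∀ q ∈ r.crossed, q.1 ≠ q.2 := by
    decide +kernel
  have hH : HasOutsideObstacleRepresentation (G.comap σ) := by
    apply hasOutsideObstacleRepresentation_of_escapeRays
    intro e he
    have h1 := List.all_eq_true.1 h e he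
    rw [Bool.or_eq_true, beq_iff_eq, List.any_eq_true] at h1
    refine h1.imp (fun h2 => ?_) fun ⟨r, hr, h2⟩ => ⟨r, hr, fun q hq hA => ?_⟩
    · exact (hl _ _ _ (hσ.ne (hne e he).1) h2).1 rfl
    · have h3 := List.all_eq_true.1 h2 q hq
      rw [beq_iff_eq] at h3
      exact Bool.false_ne_true
        ((hl _ _ _ (hσ.ne ((hne e he).2 r hr q hq)) h3).2 hA)
  let e : Fin 7 ≃ Fin 7 := Equiv.ofBijective σ (Finite.injective_iff_bijective.1 hσ)
  exact hH.of_embedding (SimpleGraph.Iso.comap e G).symm.toEmbedding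

theorem Agrees.append {G : SimpleGraph (Fin 7)} {l : List Bool} (hl : Agrees l G) :
    Agrees (l ++ [true]) G ∨ Agrees (l ++ [false]) G := by
  have hsplit : ∀ i j b c, known (l ++ [c]) i j = some b →
      known l i j = some b ∨ (pairIndex i j = l.length ∧ b = c) := by
    intro i j b c h
    rw [known, List.getElem?_append] at h
    split at h
    · exact Or.inl h
    · rename_i hlt
      obtain ⟨h1, h2⟩ := List.getElem?_eq_some_iff.1 h
      simp only [List.length_singleton, Nat.lt_one_iff] at h1
      refine Or.inr ⟨by omega, ?_⟩
      simpa using h2.symm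
  by_cases h : ∃ i j, i ≠ j ∧ pairIndex i j = l.length ∧ G.Adj i j
  · obtain ⟨i₀, j₀, hne, hidx, hA⟩ := h
    left
    intro i j b hij hb
    rcases hsplit i j b true hb with h1 | ⟨h1, rfl⟩
    · exact hl i j b hij h1
    · rcases pairIndex_eq_iff i j i₀ j₀ hij hne (h1.trans hidx.symm) with ⟨rfl, rfl⟩ | ⟨rfl, rfl⟩
      · simpa using hA
      · simpa using hA.symm
  · right
    intro i j b hij hb
    rcases hsplit i j b false hb with h1 | ⟨h1, rfl⟩
    · exact hl i j b hij h1
    · simpa using fun hA => h ⟨i, j, hij, h1, hA⟩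

theorem hasOutsideObstacleRepresentation_of_runSearch {G : SimpleGraph (Fin 7)}
    (hG : ∀ σ : Fin 7 → Fin 7, Function.Injective σ →
      ¬ adjList G vertexPairs < adjList (G.comap σ) vertexPairs) (d : ℕ) :
    ∀ (l : List Bool) (cs rest : List ℕ), Agrees l G → runSearch d l cs = some rest →
      HasOutsideObstacleRepresentation G := by
  induction d with
  | zero => intro l cs rest _ h; simp [runSearch] at h
  | succ d ih =>
    intro l cs rest hl h
    match cs with
    | [] => simp [runSearch] at h
    | 0 :: cs =>
      rw [runSearch, Option.bind_eq_some_iff] at h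
      obtain ⟨cs', h1, h2⟩ := h
      rcases hl.append with h3 | h3
      · exact ih _ _ _ h3 h1
      · exact ih _ _ _ h3 h2
    | (n + 1) :: cs =>
      rw [runSearch] at h
      split at h
      · rename_i hc
        rw [Bool.or_eq_true] at hc
        rcases hc with hc | hc
        · exact absurd (adjList_lt_of_improves hl (relabelling_injective n) vertexPairs
            (by decide) hc) (hG _ (relabelling_injective n))
        · exact hasOutsideObstacleRepresentation_of_placeable hl (relabelling_injective n) hc
      · simp at h

theorem hasOutsideObstacleRepresentation_fin_seven (G : SimpleGraph (Fin 7)) :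
    HasOutsideObstacleRepresentation G := by
  obtain ⟨τ, hτ⟩ := Finite.exists_max fun τ : Equiv.Perm (Fin 7) =>
    adjList (G.comap τ) vertexPairs
  have hH : HasOutsideObstacleRepresentation (G.comap τ) := by
    refine hasOutsideObstacleRepresentation_of_runSearch (fun σ hσ => ?_) 22 [] searchTree [] ?_
      runSearch_searchTree
    · have := hτ ((Equiv.ofBijective σ (Finite.injective_iff_bijective.1 hσ)).trans τ)
      exact this.not_gt
    · intro i j b _ h
      simp [known] at h
  exact hH.of_embedding (SimpleGraph.Iso.comap τ G).symm.toEmbedding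

end Search

theorem mainTheorem2 {V : Type*} [Fintype V] (G : SimpleGraph V) (hV : Fintype.card V ≤ 7) :
    HasOutsideObstacleRepresentation G := by
  obtain ⟨f⟩ : Nonempty (V ↪ Fin 7) :=
    Function.Embedding.nonempty_of_card_le (by simpa using hV)
  exact (hasOutsideObstacleRepresentation_fin_seven (G.map f)).of_embedding
    (SimpleGraph.Embedding.map f G)
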